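/- Let $A$ be an AW*-algebra, that is, a complex C*-algebra in which the right annihilator of every subset is of the form $pA$ for a projection $p$ (such an algebra is automatically unital). For projections write $e\le f$ if $e=ef$; $e\sim f$ if $e=vv^*$ and $f=v^*v$ for some $v\in A$; and $e\precsim f$ if $e\sim e'\le f$ for some projection $e'$. For an orthogonal family of projections, $\sum e_i$ denotes its supremum in the lattice of projections; $C(e)$ is the central cover of $e$, the least central projection above $e$. A nonzero projection $e$ is properly infinite if $e=e_1+e_2$ for some projections $e_1\sim e_2\sim e$. For such $e$ let $d(e)$ be the least cardinal strictly greater than $\operatorname{card} I$ for every orthogonal family $(e_i)_{i\in I}$ of projections with $e=\sum e_i$ and all $e_i\sim e$, and put $d(0)=0$. A properly infinite projection $e$ is equidimensional if $d(ze)=d(e)$ for every nonzero central projection $z\le C(e)$. Let $X$ be the Gelfand spectrum of the centre $Z(A)$, and for a central projection $z$ let $\operatorname{supp}(z)=\{t\in X: t(z)\neq 0\}$, which is a clopen set. For a properly infinite projection $e$ there is a unique function $D_e$ from $X$ to the cardinals that is continuous for the order topology on the cardinals and satisfies $D_e(t)=d(ze)$ for $t\in\operatorname{supp}(z)$ whenever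 $z\le C(e)$ is a central projection such that $ze$ is equidimensional, and $D_e(t)=0$ for $t\in\operatorname{supp}(1-C(e))$. **Proposition.** Let $e$ and $f$ be properly infinite projections in an AW*-algebra $A$. Then the dimension functions $D_e$ and $D_f$ exist and are unique, and $e\precsim f$ if and only if $D_e(t)\le D_f(t)$ for all $t\in X$. -/

import Mathlib

open scoped Cardinal

universe u

namespace AWStar

section Projections

variable {A : Type u} [CStarAlgebra A]

/-- A C*-algebra is an AW*-algebra when the right annihilator of every subset is of the form
`pA` for a projection `p`. (Taking adjoints gives the same for left annihilators; the annihilator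
of the empty set shows that a unit comes for free.) -/
class IsAWStarAlgebra (A : Type u) [CStarAlgebra A] : Prop where
  annihilator_eq : ∀ S : Set A, ∃ p : A, IsStarProjection p ∧
    {a : A | ∀ s ∈ S, s * a = 0} = Set.range (fun b : A => p * b)

/-- The order on projections: `e ≤ f` iff `e = ef`. -/
def ProjLE (e f : A) : Prop := e = e * f

/-- Equivalence of projections: `e = vv*` and `f = v*v` for some `v`. -/
def ProjEquiv (e f : A) : Prop := ∃ v : A, e = v * star v ∧ f = star v * v

/-- Subequivalence `e ≾ f`: `e ∼ e' ≤ f` for some projection `e'`. -/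
def SubEquiv (e f : A) : Prop := ∃ e' : A, IsStarProjection e' ∧ ProjEquiv e e' ∧ ProjLE e' f

/-- `e = ∑ pᵢ`: the `pᵢ` are pairwise orthogonal projections whose supremum in the partially
ordered set of projections is the projection `e`. -/
structure IsOrthogonalSum {I : Type u} (p : I → A) (e : A) : Prop where
  proj : ∀ i, IsStarProjection (p i)
  orthogonal : ∀ i j, i ≠ j → p i * p j = 0
  sum_proj : IsStarProjection e
  le_sum : ∀ i, ProjLE (p i) e
  sum_le : ∀ q : A, IsStarProjection q → (∀ i, ProjLE (p i) q) → ProjLE e q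

/-- A nonzero projection `e` is properly infinite when `e = e₁ + e₂` for (orthogonal)
projections `e₁ ∼ e₂ ∼ e`; orthogonality of `e₁`, `e₂` is automatic, as their sum is a
projection. -/
def IsProperlyInfinite (e : A) : Prop :=
  IsStarProjection e ∧ e ≠ 0 ∧ ∃ e₁ e₂ : A, IsStarProjection e₁ ∧ IsStarProjection e₂ ∧
    ProjEquiv e₁ e₂ ∧ ProjEquiv e₂ e ∧ e = e₁ + e₂

/-- The family `p` belongs to `Γ(e)`: `e = ∑ pᵢ` and every `pᵢ ∼ e`. -/
def MemGamma (e : A) {I : Type u} (p : I → A) : Prop :=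
  IsOrthogonalSum p e ∧ ∀ i, ProjEquiv (p i) e

open Classical in
/-- The dimension `d(e)`: the least cardinal strictly greater than the cardinality of every
family in `Γ(e)`, with `d(0) = 0`. For `e ≠ 0` the members of such a family are distinct elements
of `A`, so index types in the universe of `A` are enough and the infimum is over a nonempty set. -/
noncomputable def dim (e : A) : Cardinal.{u} :=
  if e = 0 then 0
  else sInf {κ : Cardinal.{u} | ∀ (I : Type u) (p : I → A), MemGamma e p → #I < κ}

variable (A) in
/-- The centre of `A`, as a *-subalgebra. -/
def centre : StarSubalgebra ℂ A where
  __ := Subalgebra.center ℂ A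
  star_mem' := fun ha => Set.star_mem_center ha

/-- Central projections. -/
def IsCentralProj (z : A) : Prop := IsStarProjection z ∧ z ∈ centre A

/-- `c` is the central cover of `e`: the least central projection above `e`. -/
def IsCentralCover (e c : A) : Prop :=
  IsCentralProj c ∧ ProjLE e c ∧ ∀ z : A, IsCentralProj z → ProjLE e z → ProjLE c z

/-- `e` is equidimensional: it is properly infinite and `d(ze) = d(e)` for all nonzero central
projections `z` below the central cover of `e`. -/
def IsEquidimensional (e : A) : Prop :=
  IsProperlyInfinite e ∧ ∃ c : A, IsCentralCover e c ∧
    ∀ z : A, IsCentralProj z → z ≠ 0 → ProjLE z c → dim (z * e) = dim e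

end Projections

section Spectrum

variable (A : Type u) [CStarAlgebra A]

/-- The Gelfand spectrum of the centre: the characters of the centre with the weak-* topology. -/
abbrev CenterSpec : Type u := WeakDual.characterSpace ℂ (centre A)

variable {A}

/-- The support of the Gelfand transform `t ↦ t z` of a central projection `z`. This transform is
continuous with values in `{0, 1}`, so its set of nonzeros is already closed. -/
def specSupport (z : centre A) : Set (CenterSpec A) := {t | t z ≠ 0}

/-- `D` is the dimension function of `e`: it is continuous from the spectrum of the centre to the
cardinals with the order topology, it takes the value `d(ze)` on the support of each central
projection `z` below the central cover `c` of `e` for which `ze` is equidimensional, and the value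
`0` on the support of `1 - c`. -/
def IsDimensionFunction (e : A) (D : CenterSpec A → Cardinal.{u}) : Prop :=
  @Continuous (CenterSpec A) Cardinal.{u} inferInstance (Preorder.topology Cardinal.{u}) D ∧
  ∃ c : centre A, IsCentralCover e (c : A) ∧
    (∀ z : centre A, IsCentralProj (z : A) → ProjLE (z : A) (c : A) →
      IsEquidimensional ((z : A) * e) → ∀ t ∈ specSupport z, D t = dim ((z : A) * e)) ∧
    ∀ t ∈ specSupport (1 - c), D t = 0

end Spectrum

end AWStar

namespace AWStar

/-! ### Partial isometries, equivalence and orthogonal sums of projections -/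

section Projections

variable {A : Type u} [CStarAlgebra A]

/-! The dimension is a packing number: for a projection `e ≠ 0`, `#I < dim e` holds exactly when `e`
contains an orthogonal family of copies of itself indexed by `I` (`mk_lt_dim_iff`). Packings
restrict to central summands, so `d(ze) ≥ d(e)` whenever `ze ≠ 0`, and below a properly infinite
projection they add up over orthogonal sums. Discarding a maximal central part on which the
dimension jumps therefore leaves a summand of constant dimension, and equidimensional summands occur
everywhere below the central cover (`exists_isEquidimensional`).

The comparison rests on exhaustion. Let `p` be properly infinite and `p ≾ q`. A maximal orthogonal
family of copies of `p` in `q` leaves a remainder which, on some central summand `z`, is dominated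
by the copies and hence absorbed by them (`Doubled.exists_exhaustion`); so `zq` is equivalent to a
sum of copies of `zp` over some index set `ι`. Suppose that central cuts do not raise `d(q)`. A
packing of `p` then packs `zq`, whence `d(p) ≤ d(q)` (`Doubled.dim_le_of_subEquiv`). If moreover
`d(q) ≤ d(p)` and `ι` is infinite, `ι × ι ≃ ι` makes `zq` pack `ι` copies of itself, so `#ι < d(p)`;
thus `p` has room for `ι` copies of itself and `zq ≾ zp` (`Doubled.exists_central_subEquiv`).

To globalize, `D_e(t)` is taken to be the supremum of `d(ze)` over the central `z` supported around
`t`. Every nonempty open subset of the spectrum contains the support of a nonzero central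
projection, so a failure of `D_e ≤ D_f`, being an open condition, would show on a central summand
where `e` vanishes or both projections are equidimensional. This gives monotonicity, and with it
uniqueness. Conversely, generalized comparability leaves only summands where `f ≾ e`; there the
inequality of dimensions yields `e ≾ f` on smaller summands, and these are glued together.

Without a strong operator topology, suprema are controlled by annihilators (`IsSum`), and partial
isometries are added by encoding them as projections (`ProjEquiv.sum_of_orthogonal`). -/

theorem IsStarProjection.mul_self {p : A} (h : IsStarProjection p) : p * p = p :=
  h.isIdempotentElem.eq

theorem IsStarProjection.star_eq {p : A} (h : IsStarProjection p) : star p = p :=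
  h.isSelfAdjoint.star_eq

theorem mul_mul_of_eq {R : Type*} [Semigroup R] {a b c : R} (h : a * b = c) (x : R) :
    a * (b * x) = c * x := by
  rw [← mul_assoc, h]

theorem isStarProjection_of {p : A} (h₁ : p * p = p) (h₂ : star p = p) : IsStarProjection p :=
  ⟨h₁, h₂⟩

theorem mul_eq_zero_comm {p q : A} (hp : IsStarProjection p) (hq : IsStarProjection q)
    (h : p * q = 0) : q * p = 0 := by
  have := congrArg star h
  rwa [star_mul, star_zero, IsStarProjection.star_eq hp, IsStarProjection.star_eq hq] at this

theorem mul_eq_left_comm {p q : A} (hp : IsStarProjection p) (hq : IsStarProjection q)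
    (h : p * q = p) : q * p = p := by
  have := congrArg star h
  rwa [star_mul, IsStarProjection.star_eq hp, IsStarProjection.star_eq hq] at this

theorem isStarProjection_add {p q : A} (hp : IsStarProjection p) (hq : IsStarProjection q)
    (h : p * q = 0) : IsStarProjection (p + q) := by
  have h' := mul_eq_zero_comm hp hq h
  refine isStarProjection_of ?_ ?_
  · simp [mul_add, add_mul, h, h', IsStarProjection.mul_self hp, IsStarProjection.mul_self hq]
  · simp [IsStarProjection.star_eq hp, IsStarProjection.star_eq hq]

theorem isStarProjection_sub {p q : A} (hp : IsStarProjection p) (hq : IsStarProjection q)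
    (h : p * q = p) : IsStarProjection (q - p) := by
  have h' := mul_eq_left_comm hp hq h
  refine isStarProjection_of ?_ ?_
  · simp [mul_sub, sub_mul, h, h', IsStarProjection.mul_self hp, IsStarProjection.mul_self hq]
  · simp [IsStarProjection.star_eq hp, IsStarProjection.star_eq hq]

theorem isStarProjection_mul {p q : A} (hp : IsStarProjection p) (hq : IsStarProjection q)
    (h : p * q = q * p) : IsStarProjection (p * q) := by
  have h₁ := IsStarProjection.mul_self hp
  have h₂ := IsStarProjection.mul_self hq
  refine isStarProjection_of ?_ ?_
  · rw [mul_assoc, mul_mul_of_eq h.symm, mul_assoc, h₂, mul_mul_of_eq h₁]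
  · rw [star_mul, IsStarProjection.star_eq hp, IsStarProjection.star_eq hq, h]

theorem eq_zero_of_star_mul_self {x : A} (h : star x * x = 0) : x = 0 :=
  CStarRing.star_mul_self_eq_zero_iff x |>.mp h

/-- `v` is a partial isometry with range projection `e` and source projection `f`. -/
structure Implements (v e f : A) : Prop where
  mul_star : v * star v = e
  star_mul : star v * v = f
  left : e * v = v
  right : v * f = v

namespace Implements

variable {v w e f g : A}

theorem proj_left (h : Implements v e f) : IsStarProjection e := by
  have h₁ := h.mul_star
  have h₂ := h.left
  refine isStarProjection_of ?_ ?_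
  · nth_rw 2 [← h₁]
    rw [mul_mul_of_eq h₂, h₁]
  · rw [← h₁, StarMul.star_mul, star_star]

theorem proj_right (h : Implements v e f) : IsStarProjection f := by
  have h₁ := h.star_mul
  have h₂ := h.right
  refine isStarProjection_of ?_ ?_
  · nth_rw 1 [← h₁]
    rw [mul_assoc, h₂, h₁]
  · rw [← h₁, StarMul.star_mul, star_star]

theorem star_left (h : Implements v e f) : star v * e = star v := by
  have := congrArg star h.left
  rwa [StarMul.star_mul, IsStarProjection.star_eq h.proj_left] at this

theorem star_right (h : Implements v e f) : f * star v = star v := by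
  have := congrArg star h.right
  rwa [StarMul.star_mul, IsStarProjection.star_eq h.proj_right] at this

theorem symm (h : Implements v e f) : Implements (star v) f e :=
  ⟨by rw [star_star, h.star_mul], by rw [star_star, h.mul_star], h.star_right, h.star_left⟩

theorem trans (h : Implements v e f) (h' : Implements w f g) : Implements (v * w) e g := by
  have h₁ := h.mul_star
  have h₂ := h.star_mul
  have h₃ := h.left
  have h₄ := h.right
  have h₁' := h'.mul_star
  have h₂' := h'.star_mul
  have h₃' := h'.left
  have h₄' := h'.right
  constructor
  · rw [StarMul.star_mul, mul_assoc, mul_mul_of_eq h₁', mul_mul_of_eq h₄, h₁]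
  · rw [StarMul.star_mul, mul_assoc, mul_mul_of_eq h₂, h₃', h₂']
  · rw [mul_mul_of_eq h₃]
  · rw [mul_assoc, h₄']

theorem refl (he : IsStarProjection e) : Implements e e e := by
  have h₁ := IsStarProjection.mul_self he
  have h₂ := IsStarProjection.star_eq he
  constructor <;> simp [h₁, h₂]

theorem projEquiv (h : Implements v e f) : ProjEquiv e f := ⟨v, h.mul_star.symm, h.star_mul.symm⟩

theorem of_mul_star (he : IsStarProjection e) (h : v * star v = e) :
    Implements v e (star v * v) := by
  have h₁ := IsStarProjection.mul_self he
  have h₂ := IsStarProjection.star_eq he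
  have hl : e * v = v := by
    -- The product `(ev - v)(ev - v)*` expands to `e - e - e + e`.
    have : star (e * v - v) = 0 := by
      apply eq_zero_of_star_mul_self
      rw [star_star, star_sub, StarMul.star_mul, h₂]
      simp only [sub_mul, mul_sub]
      have a1 : e * v * (star v * e) = e := by rw [mul_assoc, mul_mul_of_eq h, h₁, h₁]
      have a2 : e * v * star v = e := by rw [mul_assoc, h, h₁]
      have a3 : v * (star v * e) = e := by rw [mul_mul_of_eq h, h₁]
      rw [a1, a2, a3, h]; simp
    rw [star_eq_zero, sub_eq_zero] at this
    exact this
  exact ⟨h, rfl, hl, by rw [mul_mul_of_eq h, hl]⟩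

/-- The restriction of a partial isometry to a subprojection of its source. -/
theorem restrict (h : Implements v e f) (hg : IsStarProjection g) (hgf : g * f = g) :
    Implements (v * g) (v * g * star v) g := by
  have h₁ := h.star_mul
  have h₂ := h.right
  have h₃ := IsStarProjection.mul_self hg
  have h₄ := IsStarProjection.star_eq hg
  have h₅ := mul_eq_left_comm hg h.proj_right hgf
  constructor
  · rw [StarMul.star_mul, h₄, mul_assoc, mul_mul_of_eq h₃, mul_assoc]
  · rw [StarMul.star_mul, h₄, mul_assoc, mul_mul_of_eq h₁, h₅, h₃]
  · simp only [mul_assoc]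
    rw [mul_mul_of_eq h₁, h₅, h₃]
  · rw [mul_assoc, h₃]

theorem conj_le (h : Implements v e f) : v * g * star v * e = v * g * star v := by
  rw [mul_assoc, h.star_left]

theorem add {v₁ v₂ e₁ e₂ f₁ f₂ : A} (h₁ : Implements v₁ e₁ f₁) (h₂ : Implements v₂ e₂ f₂)
    (he : e₁ * e₂ = 0) (hf : f₁ * f₂ = 0) : Implements (v₁ + v₂) (e₁ + e₂) (f₁ + f₂) := by
  have he' := mul_eq_zero_comm h₁.proj_left h₂.proj_left he
  have hf' := mul_eq_zero_comm h₁.proj_right h₂.proj_right hf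
  have a1 := h₁.left
  have a2 := h₁.right
  have a3 := h₂.left
  have a4 := h₂.right
  have a5 := h₁.star_left
  have a6 := h₁.star_right
  have a7 := h₂.star_left
  have a8 := h₂.star_right
  have b1 : v₁ * star v₂ = 0 := by rw [← a2, ← a8, mul_assoc, mul_mul_of_eq hf, zero_mul, mul_zero]
  have b2 : v₂ * star v₁ = 0 := by rw [← a4, ← a6, mul_assoc, mul_mul_of_eq hf', zero_mul, mul_zero]
  have b3 : star v₁ * v₂ = 0 := by rw [← a5, ← a3, mul_assoc, mul_mul_of_eq he, zero_mul, mul_zero]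
  have b4 : star v₂ * v₁ = 0 := by rw [← a7, ← a1, mul_assoc, mul_mul_of_eq he', zero_mul, mul_zero]
  have b5 : e₁ * v₂ = 0 := by rw [← a3, mul_mul_of_eq he, zero_mul]
  have b6 : e₂ * v₁ = 0 := by rw [← a1, mul_mul_of_eq he', zero_mul]
  have b7 : v₁ * f₂ = 0 := by rw [← a2, mul_assoc, hf, mul_zero]
  have b8 : v₂ * f₁ = 0 := by rw [← a4, mul_assoc, hf', mul_zero]
  constructor
  · simp [add_mul, mul_add, b1, b2, h₁.mul_star, h₂.mul_star]
  · simp [add_mul, mul_add, b3, b4, h₁.star_mul, h₂.star_mul]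
  · simp [add_mul, mul_add, b5, b6, a1, a3]
  · simp [add_mul, mul_add, b7, b8, a2, a4]

end Implements

namespace ProjEquiv

variable {e f g e₁ e₂ f₁ f₂ : A}

theorem exists_implements (he : IsStarProjection e) (h : ProjEquiv e f) :
    ∃ v, Implements v e f := by
  obtain ⟨v, h₁, rfl⟩ := h
  exact ⟨v, .of_mul_star he h₁.symm⟩

theorem proj_right (he : IsStarProjection e) (h : ProjEquiv e f) : IsStarProjection f := by
  obtain ⟨v, hv⟩ := h.exists_implements he
  exact hv.proj_right

theorem refl (he : IsStarProjection e) : ProjEquiv e e := (Implements.refl he).projEquiv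

theorem symm (h : ProjEquiv e f) : ProjEquiv f e := by
  obtain ⟨v, h₁, h₂⟩ := h
  exact ⟨star v, by rw [star_star, h₂], by rw [star_star, h₁]⟩

theorem proj_left (hf : IsStarProjection f) (h : ProjEquiv e f) : IsStarProjection e :=
  h.symm.proj_right hf

theorem trans (he : IsStarProjection e) (h : ProjEquiv e f) (h' : ProjEquiv f g) :
    ProjEquiv e g := by
  obtain ⟨v, hv⟩ := h.exists_implements he
  obtain ⟨w, hw⟩ := h'.exists_implements hv.proj_right
  exact (hv.trans hw).projEquiv

theorem add (he₁ : IsStarProjection e₁) (he₂ : IsStarProjection e₂) (h₁ : ProjEquiv e₁ f₁)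
    (h₂ : ProjEquiv e₂ f₂) (he : e₁ * e₂ = 0) (hf : f₁ * f₂ = 0) :
    ProjEquiv (e₁ + e₂) (f₁ + f₂) := by
  obtain ⟨v, hv⟩ := h₁.exists_implements he₁
  obtain ⟨w, hw⟩ := h₂.exists_implements he₂
  exact (hv.add hw he hf).projEquiv

theorem eq_zero (h : ProjEquiv e f) (hf : f = 0) : e = 0 := by
  obtain ⟨v, h₁, h₂⟩ := h
  rw [hf] at h₂
  rw [h₁, eq_zero_of_star_mul_self h₂.symm, zero_mul]

theorem ne_zero (h : ProjEquiv e f) (he : e ≠ 0) : f ≠ 0 := fun hf => he (h.eq_zero hf)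

end ProjEquiv

namespace IsCentralProj

variable {z w : A}

theorem comm (hz : IsCentralProj z) (a : A) : z * a = a * z :=
  ((Subalgebra.mem_center_iff (R := ℂ)).mp hz.2 a).symm

theorem of_comm (hz : IsStarProjection z) (h : ∀ a, z * a = a * z) : IsCentralProj z :=
  ⟨hz, (Subalgebra.mem_center_iff (R := ℂ)).mpr fun a => (h a).symm⟩

theorem mul_self (hz : IsCentralProj z) : z * z = z := IsStarProjection.mul_self hz.1

theorem star_eq (hz : IsCentralProj z) : star z = z := IsStarProjection.star_eq hz.1

theorem one : IsCentralProj (1 : A) := of_comm (.one A) (by simp)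

theorem mul (hz : IsCentralProj z) (hw : IsCentralProj w) : IsCentralProj (z * w) := by
  refine of_comm (isStarProjection_mul hz.1 hw.1 (hz.comm w)) fun a => ?_
  rw [mul_assoc, hw.comm, ← mul_assoc, hz.comm, mul_assoc]

theorem one_sub (hz : IsCentralProj z) : IsCentralProj (1 - z) := by
  refine of_comm hz.1.one_sub fun a => ?_
  rw [sub_mul, mul_sub, hz.comm a, one_mul, mul_one]

theorem mul_proj (hz : IsCentralProj z) {e : A} (he : IsStarProjection e) :
    IsStarProjection (z * e) := isStarProjection_mul hz.1 he (hz.comm e)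

theorem sub (hz : IsCentralProj z) (hw : IsCentralProj w) (h : z * w = z) :
    IsCentralProj (w - z) := by
  refine of_comm (isStarProjection_sub hz.1 hw.1 h) fun a => ?_
  rw [sub_mul, mul_sub, hz.comm a, hw.comm a]

theorem mul_mul (hz : IsCentralProj z) (a b : A) : (z * a) * (z * b) = z * (a * b) := by
  rw [mul_assoc, mul_mul_of_eq (hz.comm a).symm, mul_assoc, mul_mul_of_eq hz.mul_self]

end IsCentralProj

theorem Implements.central_mul {v e f z : A} (h : Implements v e f) (hz : IsCentralProj z) :
    Implements (z * v) (z * e) (z * f) := by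
  have h₁ := hz.comm (star v)
  constructor
  · rw [StarMul.star_mul, hz.star_eq, ← h₁, hz.mul_mul, h.mul_star]
  · rw [StarMul.star_mul, hz.star_eq, ← h₁, hz.mul_mul, h.star_mul]
  · rw [hz.mul_mul, h.left]
  · rw [hz.mul_mul, h.right]

theorem ProjEquiv.central_mul {e f z : A} (he : IsStarProjection e) (h : ProjEquiv e f)
    (hz : IsCentralProj z) : ProjEquiv (z * e) (z * f) := by
  obtain ⟨v, hv⟩ := h.exists_implements he
  exact (hv.central_mul hz).projEquiv

/-- Central projections acting as the identity on `f` do so on every `e ∼ f`. -/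
theorem ProjEquiv.central_absorb {e f z : A} (hf : IsStarProjection f) (h : ProjEquiv e f)
    (hz : IsCentralProj z) (hzf : z * f = f) : z * e = e := by
  obtain ⟨v, hv⟩ := h.symm.exists_implements hf
  have h₁ : v * z = v := by rw [← hz.comm, ← hv.left, mul_mul_of_eq hzf]
  rw [← hv.star_mul, hz.comm, mul_assoc, h₁]

namespace SubEquiv

variable {e f g e₁ e₂ f₁ f₂ z : A}

theorem intro {e' : A} (he : IsStarProjection e) (h : ProjEquiv e e') (h' : e' * f = e') :
    SubEquiv e f := ⟨e', h.proj_right he, h, h'.symm⟩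

theorem of_le (he : IsStarProjection e) (h : e * f = e) : SubEquiv e f :=
  intro he (.refl he) h

theorem of_equiv (he : IsStarProjection e) (h : ProjEquiv e f) : SubEquiv e f :=
  intro he h (IsStarProjection.mul_self (h.proj_right he))

theorem trans (he : IsStarProjection e) (h : SubEquiv e f)
    (h' : SubEquiv f g) : SubEquiv e g := by
  obtain ⟨e', he', hee', hle⟩ := h
  obtain ⟨f', hf', hff', hle'⟩ := h'
  obtain ⟨v, hv⟩ := hff'.symm.exists_implements hf'
  have := hv.restrict he' hle.symm
  refine intro he (hee'.trans he this.symm.projEquiv) ?_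
  have hle'' : f' * g = f' := Eq.symm hle'
  rw [← hv.conj_le (g := e'), mul_assoc _ f', hle'']

theorem add (he₁ : IsStarProjection e₁) (he₂ : IsStarProjection e₂)
    (hf₁ : IsStarProjection f₁) (hf₂ : IsStarProjection f₂)
    (h₁ : SubEquiv e₁ f₁) (h₂ : SubEquiv e₂ f₂) (he : e₁ * e₂ = 0) (hf : f₁ * f₂ = 0) :
    SubEquiv (e₁ + e₂) (f₁ + f₂) := by
  obtain ⟨a, ha, hea, hle⟩ := h₁
  obtain ⟨b, hb, heb, hle'⟩ := h₂
  unfold ProjLE at hle hle'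
  have h₃ := mul_eq_left_comm hb hf₂ hle'.symm
  have h₄ := mul_eq_zero_comm hf₁ hf₂ hf
  have h₅ : a * b = 0 := by
    rw [hle, ← h₃, mul_assoc, mul_mul_of_eq hf, zero_mul, mul_zero]
  have h₆ : a * f₂ = 0 := by rw [hle, mul_assoc, hf, mul_zero]
  have h₇ : b * f₁ = 0 := by rw [hle', mul_assoc, h₄, mul_zero]
  refine intro (isStarProjection_add he₁ he₂ he) (.add he₁ he₂ hea heb he h₅) ?_
  simp [add_mul, mul_add, ← hle, ← hle', h₆, h₇]

theorem central_mul (he : IsStarProjection e) (h : SubEquiv e f) (hz : IsCentralProj z) :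
    SubEquiv (z * e) (z * f) := by
  obtain ⟨a, ha, hea, hle⟩ := h
  refine intro (hz.mul_proj he) (hea.central_mul he hz) ?_
  rw [hz.mul_mul, ← hle]

theorem zero_left : SubEquiv 0 f :=
  of_le (.zero A) (by simp)

theorem central_absorb (hf : IsStarProjection f) (h : SubEquiv e f)
    (hz : IsCentralProj z) (hzf : z * f = f) : z * e = e := by
  obtain ⟨a, ha, hea, hle⟩ := h
  refine hea.central_absorb ha hz ?_
  rw [← mul_eq_left_comm ha hf hle.symm, mul_mul_of_eq hzf]

end SubEquiv

/-- `e` is the supremum of the orthogonal family `p`, expressed through annihilators. -/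
structure IsSum {ι : Type*} (p : ι → A) (e : A) : Prop where
  proj : ∀ i, IsStarProjection (p i)
  orth : ∀ i j, i ≠ j → p i * p j = 0
  sum_proj : IsStarProjection e
  le : ∀ i, p i * e = p i
  ann : ∀ x : A, (∀ i, p i * x = 0) → e * x = 0

namespace IsSum

variable {ι κ : Type*} {p : ι → A} {e f z : A}

theorem le' (h : IsSum p e) (i : ι) : e * p i = p i :=
  mul_eq_left_comm (h.proj i) h.sum_proj (h.le i)

/-- Testing the annihilator condition on `1 - f` shows that `e` is also the supremum in the order of
projections. -/
theorem le_of_forall (h : IsSum p e) (hf : ∀ i, p i * f = p i) : e * f = e := by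
  have := h.ann (1 - f) fun i => by rw [mul_sub, hf i, mul_one, sub_self]
  rw [mul_sub, mul_one, sub_eq_zero] at this
  exact this.symm

theorem unique (h : IsSum p e) (h' : IsSum p f) : e = f := by
  have h₁ := h.le_of_forall h'.le
  have h₂ := h'.le_of_forall h.le
  have h₃ := mul_eq_left_comm h'.sum_proj h.sum_proj h₂
  rw [← h₁, h₃]

theorem mul_eq_zero (h : IsSum p e) (h' : IsSum (A := A) (ι := κ) q f)
    (hpq : ∀ i j, p i * q j = 0) : e * f = 0 := by
  refine h.ann _ fun i => ?_
  refine mul_eq_zero_comm h'.sum_proj (h.proj i) (h'.ann _ fun j => ?_)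
  exact mul_eq_zero_comm (h.proj i) (h'.proj j) (hpq i j)

theorem reindex (h : IsSum p e) (σ : κ ≃ ι) : IsSum (p ∘ σ) e where
  proj i := h.proj _
  orth i j hij := h.orth _ _ (σ.injective.ne hij)
  sum_proj := h.sum_proj
  le i := h.le _
  ann x hx := h.ann x fun i => by simpa using hx (σ.symm i)

theorem central_mul (h : IsSum p e) (hz : IsCentralProj z) :
    IsSum (fun i => z * p i) (z * e) where
  proj i := hz.mul_proj (h.proj i)
  orth i j hij := by rw [hz.mul_mul, h.orth i j hij, mul_zero]
  sum_proj := hz.mul_proj h.sum_proj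
  le i := by rw [hz.mul_mul, h.le]
  ann x hx := by
    rw [hz.comm, mul_assoc]
    refine h.ann _ fun i => ?_
    rw [← mul_assoc, ← hz.comm, hx]

theorem mul_of_central (h : IsSum p e) (hp : ∀ i, IsCentralProj (p i)) (he : IsCentralProj e)
    (hf : IsStarProjection f) : IsSum (fun i => p i * f) (e * f) where
  proj i := (hp i).mul_proj hf
  orth i j hij := by
    rw [mul_assoc, ← mul_assoc f, ← (hp j).comm f, mul_assoc, mul_mul_of_eq (h.orth i j hij), zero_mul]
  sum_proj := he.mul_proj hf
  le i := by
    rw [mul_assoc, ← mul_assoc f, ← he.comm f, mul_assoc, mul_mul_of_eq (h.le i),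
      IsStarProjection.mul_self hf]
  ann x hx := by
    rw [mul_assoc]
    exact h.ann _ fun i => by rw [← mul_assoc, hx]

/-- Annihilators transport along a partial isometry: if all `v pᵢ v* x` vanish, multiplying by `v*`
shows that all `pᵢ` kill `v* x`. -/
theorem conj {v a b : A} (h : IsSum p e) (hv : Implements v a b) (he : e * b = e) :
    IsSum (fun i => v * p i * star v) (v * e * star v) where
  proj i := (hv.restrict (h.proj i) (by rw [← h.le i, mul_assoc, he])).proj_left
  orth i j hij := by
    have h₂ : p i * b = p i := by rw [← h.le i, mul_assoc, he]
    simp only [mul_assoc]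
    rw [mul_mul_of_eq hv.star_mul, mul_mul_of_eq h₂, mul_mul_of_eq (h.orth i j hij), zero_mul,
      mul_zero]
  sum_proj := (hv.restrict h.sum_proj he).proj_left
  le i := by
    have h₂ : p i * b = p i := by rw [← h.le i, mul_assoc, he]
    simp only [mul_assoc]
    rw [mul_mul_of_eq hv.star_mul, mul_mul_of_eq h₂, mul_mul_of_eq (h.le i)]
  ann x hx := by
    have : e * (star v * x) = 0 := by
      refine h.ann _ fun i => ?_
      have h₂ : b * p i = p i := by
        rw [← h.le' i, mul_mul_of_eq (mul_eq_left_comm h.sum_proj hv.proj_right he)]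
      rw [← h₂, ← hv.star_mul]
      have := hx i
      simp only [mul_assoc] at this ⊢
      rw [this, mul_zero]
    rw [mul_assoc, mul_assoc, this, mul_zero]

theorem ne_zero (h : IsSum p e) {i : ι} (hi : p i ≠ 0) : e ≠ 0 := by
  rintro rfl
  exact hi (by rw [← h.le i, mul_zero])

/-- Termwise addition of two orthogonal sums. -/
theorem add {q : ι → A} (h : IsSum p e) (h' : IsSum q f) (hpq : ∀ i j, p i * q j = 0) :
    IsSum (fun i => p i + q i) (e + f) := by
  have hef := h.mul_eq_zero h' hpq
  have hfe := mul_eq_zero_comm h.sum_proj h'.sum_proj hef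
  have hqp : ∀ i j, q i * p j = 0 := fun i j =>
    mul_eq_zero_comm (h.proj j) (h'.proj i) (hpq j i)
  refine ⟨fun i => isStarProjection_add (h.proj i) (h'.proj i) (hpq i i), fun i j hij => ?_,
    isStarProjection_add h.sum_proj h'.sum_proj hef, fun i => ?_, fun x hx => ?_⟩
  · simp [add_mul, mul_add, hpq, hqp, h.orth i j hij, h'.orth i j hij]
  · have h₁ : p i * f = 0 := by rw [← h.le i, mul_assoc, hef, mul_zero]
    have h₂ : q i * e = 0 := by rw [← h'.le i, mul_assoc, hfe, mul_zero]
    simp [add_mul, mul_add, h.le, h'.le, h₁, h₂]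
  · have h₁ : e * x = 0 := h.ann x fun i => by
      have : p i * ((p i + q i) * x) = 0 := by rw [hx, mul_zero]
      rwa [← mul_assoc, mul_add, hpq, add_zero, IsStarProjection.mul_self (h.proj i)] at this
    have h₂ : f * x = 0 := h'.ann x fun i => by
      have : q i * ((p i + q i) * x) = 0 := by rw [hx, mul_zero]
      rwa [← mul_assoc, mul_add, hqp, zero_add, IsStarProjection.mul_self (h'.proj i)] at this
    rw [add_mul, h₁, h₂, add_zero]

end IsSum

end Projections

/-! ### Supports, suprema and central covers from annihilators -/

section AWStarAlgebra

variable {A : Type u} [CStarAlgebra A] [IsAWStarAlgebra A]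

/-- Every set has a projection onto the complement of its right annihilator. -/
theorem exists_support (S : Set A) : ∃ p : A, IsStarProjection p ∧ (∀ s ∈ S, s * p = s) ∧
    ∀ x, (∀ s ∈ S, s * x = 0) → p * x = 0 := by
  obtain ⟨q, hq, h⟩ := IsAWStarAlgebra.annihilator_eq S
  refine ⟨1 - q, hq.one_sub, fun s hs => ?_, fun x hx => ?_⟩
  · have : q ∈ {a : A | ∀ s ∈ S, s * a = 0} := by
      rw [h]; exact ⟨q, IsStarProjection.mul_self hq⟩
    rw [mul_sub, this s hs, mul_one, sub_zero]
  · have : x ∈ {a : A | ∀ s ∈ S, s * a = 0} := hx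
    rw [h] at this
    obtain ⟨b, rfl⟩ := this
    rw [← mul_assoc, hq.one_sub_mul_self, zero_mul]

/-- The supremum is the support projection of the set of all terms. -/
theorem exists_isSum {ι : Type*} {p : ι → A} (hp : ∀ i, IsStarProjection (p i))
    (ho : ∀ i j, i ≠ j → p i * p j = 0) : ∃ e, IsSum p e := by
  obtain ⟨e, he, h₁, h₂⟩ := exists_support (Set.range p)
  exact ⟨e, hp, ho, he, fun i => h₁ _ ⟨i, rfl⟩, fun x hx => h₂ x (by rintro _ ⟨i, rfl⟩; exact hx i)⟩

/-- The support projection of a set which is an ideal up to right annihilators is central. -/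
theorem exists_central_support (S : Set A)
    (hS : ∀ x, (∀ s ∈ S, s * x = 0) → ∀ a, ∀ s ∈ S, s * (a * x) = 0) :
    ∃ p : A, IsCentralProj p ∧ (∀ s ∈ S, s * p = s) ∧ ∀ x, (∀ s ∈ S, s * x = 0) → p * x = 0 := by
  obtain ⟨p, hp, h₁, h₂⟩ := exists_support S
  refine ⟨p, .of_comm hp fun a => ?_, h₁, h₂⟩
  have key : ∀ a, p * (a * (1 - p)) = 0 := fun a => by
    refine h₂ _ (hS _ (fun s hs => ?_) a)
    rw [mul_sub, h₁ s hs, mul_one, sub_self]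
  have k₁ : ∀ a, p * a = p * a * p := fun a => by
    have := key a
    rwa [mul_sub, mul_sub, mul_one, sub_eq_zero, ← mul_assoc] at this
  have k₂ := congrArg star (k₁ (star a))
  simp only [star_mul, star_star, IsStarProjection.star_eq hp] at k₂
  rw [k₁, k₂, mul_assoc]

/-- Commuting with all terms makes their annihilator a left ideal, so their support is central; by
uniqueness it is `e`. -/
theorem IsSum.isCentralProj {ι : Type*} {p : ι → A} {e : A} (h : IsSum p e)
    (hp : ∀ i, IsCentralProj (p i)) : IsCentralProj e := by
  obtain ⟨q, hq, h₁, h₂⟩ := exists_central_support (Set.range p) (by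
    rintro x hx a _ ⟨i, rfl⟩
    rw [← mul_assoc, (hp i).comm, mul_assoc, hx _ ⟨i, rfl⟩, mul_zero])
  have : IsSum p q := ⟨h.proj, h.orth, hq.1, fun i => h₁ _ ⟨i, rfl⟩,
    fun x hx => h₂ x (by rintro _ ⟨i, rfl⟩; exact hx i)⟩
  rw [h.unique this]
  exact hq

/-- Existence of the central cover, with its characterization by annihilation. -/
theorem exists_centralCover (e : A) : ∃ c, IsCentralProj c ∧ c * e = e ∧
    (∀ x, (∀ a, e * (a * x) = 0) → c * x = 0) ∧ ∀ z, IsCentralProj z → z * e = e → c * z = c := by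
  obtain ⟨c, hc, h₁, h₂⟩ := exists_central_support (Set.range fun a => e * a) (by
    rintro x hx a _ ⟨b, rfl⟩
    have := hx _ ⟨b * a, rfl⟩
    simpa only [mul_assoc] using this)
  have h₃ : c * e = e := by
    have := h₁ _ ⟨1, rfl⟩
    simp only [mul_one] at this
    rwa [← hc.comm] at this
  have h₄ : ∀ x, (∀ a, e * (a * x) = 0) → c * x = 0 := fun x hx => h₂ x (by
    rintro _ ⟨b, rfl⟩
    rw [mul_assoc, hx])
  refine ⟨c, hc, h₃, h₄, fun z hz hze => ?_⟩
  have := h₄ (1 - z) fun a => by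
    rw [← hz.one_sub.comm, ← mul_assoc, ← hz.one_sub.comm, sub_mul, hze, one_mul, sub_self,
      zero_mul]
  rw [mul_sub, mul_one, sub_eq_zero] at this
  exact this.symm

end AWStarAlgebra

/-! ### Iterates of a projection under a partial isometry -/

section Shift

variable {A : Type u} [CStarAlgebra A]

/-- The images of `d` under the powers of `v`. -/
def shift (v d : A) : ℕ → A
  | 0 => d
  | n + 1 => v * shift v d n * star v

variable {v a b d : A}

theorem shift_implements (hv : Implements v b a) (hba : b * a = b) (hd : IsStarProjection d)
    (hda : d * a = d) (n : ℕ) : shift v d n * a = shift v d n ∧ ProjEquiv (shift v d n) d := by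
  induction n with
  | zero => exact ⟨hda, .refl hd⟩
  | succ n ih =>
    have hp := ih.2.proj_left hd
    have h₁ := hv.restrict hp ih.1
    refine ⟨?_, h₁.projEquiv.trans h₁.proj_left ih.2⟩
    change v * shift v d n * star v * a = v * shift v d n * star v
    rw [← hv.conj_le, mul_assoc, hba]

/-- The starting projection `d` is orthogonal to `b`, which dominates every later iterate;
conjugation by `v` preserves orthogonality below `a` and moves this relation along the sequence. -/
theorem shift_orth (hv : Implements v b a) (hba : b * a = b) (hd : IsStarProjection d)
    (hda : d * a = d) (hdb : d * b = 0) {m n : ℕ} (hmn : m ≠ n) :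
    shift v d m * shift v d n = 0 := by
  have key : ∀ m k, shift v d m * shift v d (m + k + 1) = 0 := by
    intro m k
    induction m with
    | zero =>
      change d * (v * shift v d (0 + k) * star v) = 0
      rw [← hv.left]
      simp only [← mul_assoc]
      simp only [hdb, zero_mul]
    | succ m ih =>
      rw [show m + 1 + k + 1 = (m + k + 1) + 1 by ring]
      change v * shift v d m * star v * (v * shift v d (m + k + 1) * star v) = 0
      simp only [mul_assoc]
      rw [mul_mul_of_eq hv.star_mul, mul_mul_of_eq (shift_implements hv hba hd hda m).1,
        mul_mul_of_eq ih, zero_mul, mul_zero]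
  rcases lt_or_gt_of_ne hmn with h | h
  · obtain ⟨k, rfl⟩ := Nat.exists_eq_add_of_lt h
    exact key m k
  · obtain ⟨k, rfl⟩ := Nat.exists_eq_add_of_lt h
    exact mul_eq_zero_comm ((shift_implements hv hba hd hda n).2.proj_left hd)
      ((shift_implements hv hba hd hda _).2.proj_left hd) (key n k)

end Shift

/-! ### Schröder–Bernstein and addition of partial isometries -/

section AWStarAlgebra

variable {A : Type u} [CStarAlgebra A] [IsAWStarAlgebra A]

/-- The Schröder–Bernstein theorem in its sandwich form. -/
theorem ProjEquiv.of_sandwich {a b c : A} (ha : IsStarProjection a) (hb : IsStarProjection b)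
    (hba : b * a = b) (hcb : c * b = c) (hac : ProjEquiv a c) : ProjEquiv a b := by
  obtain ⟨v, hv⟩ := hac.symm.exists_implements (hac.proj_right ha)
  have hc := hac.proj_right ha
  have hca : c * a = c := by rw [← hcb, mul_assoc, hba]
  have hab := mul_eq_left_comm hb ha hba
  have hbc := mul_eq_left_comm hc hb hcb
  have hd : IsStarProjection (a - b) := isStarProjection_sub hb ha hba
  have hda : (a - b) * a = a - b := by
    rw [sub_mul, IsStarProjection.mul_self ha, hba]
  have hdb : (a - b) * b = 0 := by
    rw [sub_mul, IsStarProjection.mul_self hb, hab, sub_self]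
  have hdc : (a - b) * c = 0 := by
    rw [← hbc, ← mul_assoc, hdb, zero_mul]
  have hs := shift_implements hv hca hd hda
  obtain ⟨D, hD⟩ := exists_isSum (p := shift v (a - b)) (fun n => (hs n).2.proj_left hd)
    (fun m n hmn => shift_orth hv hca hd hda hdc hmn)
  have hDa : D * a = D := hD.le_of_forall fun n => (hs n).1
  have hE := hv.restrict hD.sum_proj hDa
  have hEc : v * D * star v * c = v * D * star v := hv.conj_le
  have hEb : v * D * star v * b = v * D * star v := by
    rw [← hEc, mul_assoc, hcb]
  have hbE := mul_eq_left_comm hE.proj_left hb hEb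
  have hdE : (a - b) * (v * D * star v) = 0 := by
    rw [← hbE, ← mul_assoc, hdb, zero_mul]
  have hEd := mul_eq_zero_comm hd hE.proj_left hdE
  -- Conjugation by `v` shifts the sequence by one, so its supremum satisfies `D = (a - b) + vDv*`.
  -- Hence `a = D + (a - D)` and `b = vDv* + (a - D)`, which differ only by exchanging `D` for the
  -- equivalent `vDv*`.
  have hS : IsSum (shift v (a - b)) ((a - b) + v * D * star v) := by
    have hconj := hD.conj hv hDa
    refine ⟨hD.proj, hD.orth, isStarProjection_add hd hE.proj_left hdE, fun n => ?_, fun x hx => ?_⟩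
    · cases n with
      | zero =>
        change (a - b) * _ = a - b
        rw [mul_add, hdE, add_zero, IsStarProjection.mul_self hd]
      | succ n =>
        have h₁ := hconj.le n
        change v * shift v (a - b) n * star v * _ = v * shift v (a - b) n * star v
        rw [mul_add, h₁, ← h₁, mul_assoc _ _ (a - b), hEd, mul_zero, zero_add]
    · rw [add_mul, hconj.ann x fun n => hx (n + 1), add_zero]
      exact hx 0
  have hDE : D = (a - b) + v * D * star v := hD.unique hS
  have haD : a * D = D := mul_eq_left_comm hD.sum_proj ha hDa
  have hr : IsStarProjection (a - D) := isStarProjection_sub hD.sum_proj ha hDa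
  have hDr : D * (a - D) = 0 := by
    rw [mul_sub, hDa, IsStarProjection.mul_self hD.sum_proj, sub_self]
  have hED : v * D * star v * D = v * D * star v := by
    nth_rw 2 [hDE]
    rw [mul_add, hEd, zero_add, IsStarProjection.mul_self hE.proj_left]
  have hEr : v * D * star v * (a - D) = 0 := by
    rw [mul_sub, hED, ← hEc, mul_assoc _ c, hca, sub_self]
  have := ProjEquiv.add hD.sum_proj hr hE.symm.projEquiv (.refl hr) hDr hEr
  have e₁ : D + (a - D) = a := by abel
  have e₂ : v * D * star v + (a - D) = b := by
    nth_rw 2 [hDE]; abel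
  rwa [e₁, e₂] at this

/-- With `f ∼ b ≤ e` and `e ∼ c ≤ b`, the projection `b` is sandwiched between `c` and `e`. -/
theorem SubEquiv.antisymm {e f : A} (he : IsStarProjection e) (hf : IsStarProjection f)
    (h : SubEquiv e f) (h' : SubEquiv f e) : ProjEquiv e f := by
  obtain ⟨b, hb, hfb, hbe⟩ := h'
  obtain ⟨c, hc, hec, hcb⟩ := h.trans he (.of_equiv hf hfb)
  exact (ProjEquiv.of_sandwich he hb (Eq.symm hbe) (Eq.symm hcb) hec).trans he hfb.symm

/-- Partial isometries between orthogonal sums can be added. -/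
theorem ProjEquiv.sum_of_orthogonal {ι : Type*} {p q : ι → A} {e f : A} (hp : IsSum p e)
    (hq : IsSum q f) (hef : e * f = 0) (h : ∀ i, ProjEquiv (p i) (q i)) : ProjEquiv e f := by
  choose v hv using fun i => (h i).exists_implements (hp.proj i)
  have hfe := mul_eq_zero_comm hp.sum_proj hq.sum_proj hef
  have hpq : ∀ i j, p i * q j = 0 := fun i j => by
    rw [← hp.le i, ← hq.le' j, mul_assoc, mul_mul_of_eq hef, zero_mul, mul_zero]
  have hqp : ∀ i j, q i * p j = 0 := fun i j =>
    mul_eq_zero_comm (hp.proj j) (hq.proj i) (hpq j i)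
  set h : ι → A := fun i => p i + q i with hh
  set s : ι → A := fun i => v i + star (v i) with hsdef
  have hs : IsSum h (e + f) := hp.add hq hpq
  have vv : ∀ i, v i * v i = 0 := fun i => by
    nth_rw 1 [← (hv i).right]
    rw [← (hv i).left, mul_assoc, mul_mul_of_eq (hqp i i), zero_mul, mul_zero]
  have vv' : ∀ i, star (v i) * star (v i) = 0 := fun i => by rw [← star_mul, vv, star_zero]
  have pv' : ∀ i, p i * star (v i) = 0 := fun i => by
    rw [← (hv i).star_right, mul_mul_of_eq (hpq i i), zero_mul]
  have qv : ∀ i, q i * v i = 0 := fun i => by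
    rw [← (hv i).left, mul_mul_of_eq (hqp i i), zero_mul]
  have vp : ∀ i, v i * p i = 0 := fun i => by
    rw [← (hv i).right, mul_assoc, hqp, mul_zero]
  have v'q : ∀ i, star (v i) * q i = 0 := fun i => by
    rw [← (hv i).star_left, mul_assoc, hpq, mul_zero]
  have hhh : ∀ i, h i * h i = h i := fun i => IsStarProjection.mul_self (hs.proj i)
  have hss : ∀ i, s i * s i = h i := fun i => by
    simp [hsdef, hh, add_mul, mul_add, vv, vv', (hv i).mul_star, (hv i).star_mul, add_comm]
  have hhs : ∀ i, h i * s i = s i := fun i => by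
    simp [hsdef, hh, add_mul, mul_add, pv', qv, (hv i).left, (hv i).star_right]
  have hsh : ∀ i, s i * h i = s i := fun i => by
    simp [hsdef, hh, add_mul, mul_add, vp, v'q, (hv i).right, (hv i).star_left, add_comm]
  -- The element `sᵢ = vᵢ + vᵢ*` is a self-adjoint unitary of the corner of `hᵢ`, and `gᵢ` is its
  -- spectral projection at `1`, the graph of `vᵢ`. The `vᵢ` cannot be summed directly, but the `gᵢ`
  -- have a supremum `G`, and its corner `2eGf` restricts to every `vᵢ`.
  set g : ι → A := fun i => (2⁻¹ : ℂ) • (h i + s i) with hg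
  have gh : ∀ i, g i * h i = g i := fun i => by
    simp [hg, add_mul, hhh, hsh]
  have hgm : ∀ i, h i * g i = g i := fun i => by
    simp [hg, mul_add, hhh, hhs]
  have gproj : ∀ i, IsStarProjection (g i) := fun i => by
    refine isStarProjection_of ?_ ?_
    · simp only [hg, smul_mul_smul_comm, add_mul, mul_add, hhh, hhs, hsh, hss]
      rw [add_comm (s i) (h i), ← two_smul ℂ, smul_smul]
      norm_num
    · simp only [hg, star_smul, star_add, IsStarProjection.star_eq (hs.proj i), hsdef, star_star]
      simp [add_comm]
  have gorth : ∀ i j, i ≠ j → g i * h j = 0 := fun i j hij => by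
    rw [← gh i, mul_assoc, hs.orth i j hij, mul_zero]
  obtain ⟨G, hG⟩ := exists_isSum gproj fun i j hij => by
    rw [← hgm j, ← mul_assoc, gorth i j hij, zero_mul]
  have Gh : ∀ i, G * h i = g i := fun i => by
    have : G * (h i - g i) = 0 := hG.ann _ fun j => by
      by_cases hij : j = i
      · subst hij
        rw [mul_sub, gh, IsStarProjection.mul_self (gproj j), sub_self]
      · rw [mul_sub, gorth j i hij, ← hgm i, ← mul_assoc, gorth j i hij, zero_mul, sub_zero]
    rw [mul_sub, sub_eq_zero, hG.le'] at this
    exact this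
  have ep : ∀ i, e * p i = p i := hp.le'
  have fq : ∀ i, f * q i = q i := hq.le'
  have eq0 : ∀ i, e * q i = 0 := fun i => by rw [← fq, ← mul_assoc, hef, zero_mul]
  have fp0 : ∀ i, f * p i = 0 := fun i => by rw [← ep, ← mul_assoc, hfe, zero_mul]
  have hp' : ∀ i, h i * p i = p i := fun i => by
    simp [hh, add_mul, hqp, IsStarProjection.mul_self (hp.proj i)]
  have hq' : ∀ i, h i * q i = q i := fun i => by
    simp [hh, add_mul, hpq, IsStarProjection.mul_self (hq.proj i)]
  have Gq : ∀ i, G * q i = (2⁻¹ : ℂ) • (q i + v i) := fun i => by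
    rw [← hq' i, ← mul_assoc, Gh, hq']
    simp [hg, hh, hsdef, add_mul, hpq, v'q, (hv i).right, IsStarProjection.mul_self (hq.proj i)]
  have Gp : ∀ i, G * p i = (2⁻¹ : ℂ) • (p i + star (v i)) := fun i => by
    rw [← hp' i, ← mul_assoc, Gh, hp']
    simp [hg, hh, hsdef, add_mul, hqp, vp, (hv i).star_left, IsStarProjection.mul_self (hp.proj i)]
  have ev : ∀ i, e * v i = v i := fun i => by
    rw [← (hv i).left, mul_mul_of_eq (ep i)]
  have fv : ∀ i, f * star (v i) = star (v i) := fun i => by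
    rw [← (hv i).star_right, mul_mul_of_eq (fq i)]
  set w : A := (2 : ℂ) • (e * G * f) with hw
  have hw' : star w = (2 : ℂ) • (f * G * e) := by
    simp [hw, IsStarProjection.star_eq hp.sum_proj, IsStarProjection.star_eq hq.sum_proj,
      IsStarProjection.star_eq hG.sum_proj, mul_assoc]
  have wq : ∀ i, w * q i = v i := fun i => by
    rw [hw, smul_mul_assoc, mul_assoc, mul_assoc, fq, Gq, mul_smul_comm, smul_smul, mul_add,
      eq0, ev]
    norm_num
  have wp : ∀ i, star w * p i = star (v i) := fun i => by
    rw [hw', smul_mul_assoc, mul_assoc, mul_assoc, ep, Gp, mul_smul_comm, smul_smul, mul_add,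
      fp0, fv]
    norm_num
  have we : e * w = w := by
    rw [hw, mul_smul_comm, mul_assoc, mul_mul_of_eq (IsStarProjection.mul_self hp.sum_proj)]
  have wf : f * star w = star w := by
    rw [hw', mul_smul_comm, mul_assoc, mul_mul_of_eq (IsStarProjection.mul_self hq.sum_proj)]
  have pw : ∀ i, p i * w = v i := fun i => by
    have := congrArg star (wp i)
    rwa [star_mul, star_star, star_star, IsStarProjection.star_eq (hp.proj i)] at this
  have qw : ∀ i, q i * star w = star (v i) := fun i => by
    have := congrArg star (wq i)
    rwa [star_mul, IsStarProjection.star_eq (hq.proj i)] at this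
  -- Each `pᵢ` kills `ww* - e` and each `qᵢ` kills `w*w - f`, so the suprema `e` and `f` kill them
  -- too.
  refine ⟨w, ?_, ?_⟩
  · have := hp.ann (w * star w - e) fun i => by
      rw [mul_sub, mul_mul_of_eq (pw i), hp.le, ← (hv i).right, mul_assoc, qw, (hv i).mul_star,
        sub_self]
    rw [mul_sub, mul_mul_of_eq we, IsStarProjection.mul_self hp.sum_proj, sub_eq_zero] at this
    exact this.symm
  · have := hq.ann (star w * w - f) fun i => by
      rw [mul_sub, mul_mul_of_eq (qw i), hq.le, ← (hv i).star_left, mul_assoc, pw, (hv i).star_mul,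
        sub_self]
    rw [mul_sub, mul_mul_of_eq wf, IsStarProjection.mul_self hq.sum_proj, sub_eq_zero] at this
    exact this.symm

end AWStarAlgebra

/-! ### Cut-offs by functional calculus -/

section Spectral

variable {A : Type u} [CStarAlgebra A]

/-- A nonzero element of the form `b = xx*` is invertible, through the functional calculus,
over a nonzero element `s`. -/
theorem exists_cutoff {x : A} (hx : x ≠ 0) : ∃ s k g : A, s ≠ 0 ∧ star k = k ∧
    s * (k * (x * star x) * k) = s ∧ s = g * (x * star x) ∧
    ∀ a, Commute (x * star x) a → Commute s a ∧ Commute k a := by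
  set b := x * star x with hb
  have hsa : IsSelfAdjoint b := .mul_star_self x
  have hb0 : b ≠ 0 := fun h => hx (CStarRing.mul_star_self_eq_zero_iff x |>.mp h)
  have hnn : ∀ t ∈ spectrum ℝ b, 0 ≤ t := by
    have := spectrum_star_mul_self_nonneg (b := star x)
    rwa [star_star] at this
  obtain ⟨t₀, ht₀, hpos⟩ : ∃ t ∈ spectrum ℝ b, 0 < t := by
    by_contra! h
    refine hb0 ?_
    have : cfc (id : ℝ → ℝ) b = cfc (fun _ => (0 : ℝ)) b :=
      cfc_congr fun t ht => le_antisymm (h t ht) (hnn t ht)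
    rwa [cfc_id ℝ b, cfc_const_zero] at this
  -- The cut is placed strictly between `0` and `t₀`: the function `max (t - c) 0` is then nonzero
  -- at `t₀`, and wherever it is nonzero `max t c = t`, so `fk` is there the inverse square root of
  -- `t`.
  set c := t₀ / 2 with hc
  have hc0 : 0 < c := by positivity
  set fs : ℝ → ℝ := fun t => max (t - c) 0
  set fk : ℝ → ℝ := fun t => (Real.sqrt (max t c))⁻¹
  set fg : ℝ → ℝ := fun t => max (t - c) 0 * (max t c)⁻¹
  have hmax : ∀ t, max t c ≠ 0 := fun t => (lt_max_of_lt_right hc0).ne'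
  have hsq : ∀ t, Real.sqrt (max t c) ≠ 0 := fun t =>
    (Real.sqrt_pos.mpr (lt_max_of_lt_right hc0)).ne'
  have cs : Continuous fs := by fun_prop
  have ck : Continuous fk := by
    refine Continuous.inv₀ (by fun_prop) hsq
  have cg : Continuous fg := by
    refine Continuous.mul (by fun_prop) (Continuous.inv₀ (by fun_prop) hmax)
  refine ⟨cfc fs b, cfc fk b, cfc fg b, ?_, ?_, ?_, ?_, fun a ha => ?_⟩
  · intro h
    have h' : cfc fs b = cfc (fun _ => (0 : ℝ)) b := by rw [h, cfc_const_zero]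
    have := (cfc_eq_cfc_iff_eqOn (R := ℝ) (a := b) (f := fs) (g := fun _ => (0 : ℝ)) hsa
      cs.continuousOn continuousOn_const).mp h' ht₀
    simp only [fs] at this
    have h2 : t₀ - c ≤ max (t₀ - c) 0 := le_max_left _ _
    rw [this] at h2
    linarith
  · exact (cfc_predicate fk b : IsSelfAdjoint _).star_eq
  · suffices cfc fs b * (cfc fk b * cfc id b * cfc fk b) = cfc fs b by rwa [cfc_id ℝ b] at this
    rw [← cfc_mul fk id b ck.continuousOn continuousOn_id,
      ← cfc_mul (fun t => fk t * id t) fk b (ck.mul continuous_id).continuousOn ck.continuousOn,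
      ← cfc_mul fs (fun t => fk t * id t * fk t) b cs.continuousOn ((ck.mul continuous_id).mul ck).continuousOn]
    refine cfc_congr fun t _ => ?_
    simp only [fs, fk, id]
    rcases le_total t c with h | h
    · rw [max_eq_right (by linarith : t - c ≤ 0), zero_mul]
    · have h0 : Real.sqrt t * Real.sqrt t = t := Real.mul_self_sqrt (by linarith)
      have h1 : Real.sqrt t ≠ 0 := (Real.sqrt_pos.mpr (by linarith)).ne'
      rw [max_eq_left h]
      field_simp
      rw [pow_two, h0, mul_comm]
  · suffices cfc fs b = cfc fg b * cfc id b by rwa [cfc_id ℝ b] at this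
    rw [← cfc_mul fg id b cg.continuousOn continuousOn_id]
    refine cfc_congr fun t _ => ?_
    simp only [fs, fg, id]
    rcases le_total t c with h | h
    · rw [max_eq_right (by linarith : t - c ≤ 0), zero_mul, zero_mul]
    · rw [max_eq_left h]
      have : t ≠ 0 := by linarith
      field_simp
  · exact ⟨ha.cfc_real fs, ha.cfc_real fk⟩

end Spectral

/-! ### Projections below nonzero elements -/

section AWStarAlgebra

variable {A : Type u} [CStarAlgebra A] [IsAWStarAlgebra A]

/-- Below every nonzero central element of the form `xx*` there is a nonzero central projection. -/
theorem exists_centralProj_mul {x : A} (hx : x ≠ 0)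
    (hc : ∀ a, Commute (x * star x) a) : ∃ z y : A, IsCentralProj z ∧ z ≠ 0 ∧ (∀ a, Commute y a) ∧
      z = x * star x * y := by
  obtain ⟨s, k, g, hs, hk, h₁, h₂, hcomm⟩ := exists_cutoff hx
  obtain ⟨p, hp, hp₁, hp₂⟩ := exists_central_support {s} (by
    rintro y hy a _ rfl
    rw [← mul_assoc, (hcomm a (hc a)).1.eq, mul_assoc, hy _ rfl, mul_zero])
  have h₃ : p * (1 - k * (x * star x) * k) = 0 := hp₂ _ (by
    rintro _ rfl
    rw [mul_sub, h₁, mul_one, sub_self])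
  rw [mul_sub, mul_one, sub_eq_zero] at h₃
  -- Since `p = p(kxx*k)` and `xx*` commutes with everything, `p = xx* · k²p`.
  refine ⟨p, k * k * p, hp, ?_, fun a => ?_, ?_⟩
  · rintro rfl
    exact hs (by rw [← hp₁ s rfl, mul_zero])
  · have := (hcomm a (hc a)).2
    exact (this.mul_left this).mul_left (hp.comm a)
  · rwa [← (hc k).eq, hp.comm, mul_assoc (x * star x), mul_assoc (x * star x)] at h₃

/-- If `eAf ≠ 0`, then `e` and `f` have equivalent nonzero subprojections. -/
theorem exists_equiv_subprojections {e f y : A} (he : IsStarProjection e)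
    (hf : IsStarProjection f) (h : e * (y * f) ≠ 0) : ∃ a b : A, IsStarProjection a ∧ a ≠ 0 ∧
      a * e = a ∧ b * f = b ∧ ProjEquiv a b := by
  set x := e * (y * f) with hx
  have hex : e * x = x := by rw [hx, mul_mul_of_eq (IsStarProjection.mul_self he)]
  have hxf : x * f = x := by
    rw [hx, mul_assoc, mul_assoc, IsStarProjection.mul_self hf]
  have hxe : star x * e = star x := by
    have := congrArg star hex
    rwa [star_mul, IsStarProjection.star_eq he] at this
  clear_value x
  obtain ⟨s, k, g, hs, hk, h₁, h₂, -⟩ := exists_cutoff h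
  obtain ⟨p, hp, hp₁, hp₂⟩ := exists_support {s}
  have h₃ : p * (1 - k * (x * star x) * k) = 0 := hp₂ _ (by
    rintro _ rfl
    rw [mul_sub, h₁, mul_one, sub_self])
  rw [mul_sub, mul_one, sub_eq_zero] at h₃
  have h₄ : p * (1 - e) = 0 := hp₂ _ (by
    rintro _ rfl
    rw [h₂, mul_sub, mul_one, mul_assoc, mul_assoc, hxe, sub_self])
  rw [mul_sub, mul_one, sub_eq_zero] at h₄
  -- The factor `k` normalizes `x` over `p`, as in a polar decomposition: `p(kxx*k)p = p`.
  have hv : (p * k * x) * star (p * k * x) = p := by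
    simp only [star_mul, hk, IsStarProjection.star_eq hp]
    have h₅ : p * k * x * (star x * (k * p)) = p * (k * (x * star x) * k) * p := by
      simp only [mul_assoc]
    rw [h₅, ← h₃, IsStarProjection.mul_self hp]
  have hI := Implements.of_mul_star hp hv
  refine ⟨p, _, hp, ?_, h₄.symm, ?_, hI.projEquiv⟩
  · rintro rfl
    exact hs (by rw [← hp₁ s rfl, mul_zero])
  · rw [mul_assoc, mul_assoc (p * k), hxf]

end AWStarAlgebra
/-- A maximal set of elements satisfying `P` that are pairwise related by `R`. -/
theorem exists_maximal_pairwise {α : Type*} (P : α → Prop) (R : α → α → Prop) :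
    ∃ S : Set α, (∀ s ∈ S, P s) ∧ S.Pairwise R ∧
      ∀ x, P x → (∀ s ∈ S, R x s ∧ R s x) → x ∈ S := by
  obtain ⟨S, hS⟩ := zorn_subset {S : Set α | (∀ s ∈ S, P s) ∧ S.Pairwise R} (by
    intro C hC hchain
    refine ⟨⋃₀ C, ⟨?_, ?_⟩, fun s hs => Set.subset_sUnion_of_mem hs⟩
    · rintro s ⟨T, hT, hs⟩
      exact (hC hT).1 s hs
    · exact (Set.pairwise_sUnion hchain.directedOn).mpr fun T hT => (hC hT).2)
  refine ⟨S, hS.prop.1, hS.prop.2, fun x hx hR => ?_⟩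
  have : insert x S ∈ {S : Set α | (∀ s ∈ S, P s) ∧ S.Pairwise R} := by
    refine ⟨?_, ?_⟩
    · rintro s (rfl | hs)
      · exact hx
      · exact hS.prop.1 s hs
    · exact Set.pairwise_insert.mpr ⟨hS.prop.2, fun s hs _ => hR s hs⟩
  exact hS.le_of_ge this (Set.subset_insert x S) (Set.mem_insert x S)

/-! ### Generalized comparability for orthogonal projections -/

section AWStarAlgebra

variable {A : Type u} [CStarAlgebra A] [IsAWStarAlgebra A]

/-- Generalized comparability of orthogonal projections. -/
theorem comparability_of_orthogonal {e f : A} (he : IsStarProjection e) (hf : IsStarProjection f)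
    (hef : e * f = 0) : ∃ z : A, IsCentralProj z ∧ SubEquiv (z * f) (z * e) ∧
      SubEquiv ((1 - z) * e) ((1 - z) * f) := by
  obtain ⟨S, hS, hpw, hmax⟩ := exists_maximal_pairwise
    (fun s : A × A => IsStarProjection s.1 ∧ s.1 ≠ 0 ∧ s.1 * e = s.1 ∧ s.2 * f = s.2 ∧
      ProjEquiv s.1 s.2) (fun s t => s.1 * t.1 = 0 ∧ s.2 * t.2 = 0)
  have hp₂ : ∀ s ∈ S, IsStarProjection s.2 := fun s hs => (hS s hs).2.2.2.2.proj_right (hS s hs).1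
  obtain ⟨a, ha⟩ := exists_isSum (p := fun s : S => s.1.1) (fun s => (hS s s.2).1)
    (fun s t hst => (hpw s.2 t.2 (Subtype.coe_injective.ne hst)).1)
  obtain ⟨b, hb⟩ := exists_isSum (p := fun s : S => s.1.2) (fun s => hp₂ s s.2)
    (fun s t hst => (hpw s.2 t.2 (Subtype.coe_injective.ne hst)).2)
  have hae : a * e = a := ha.le_of_forall fun s => (hS s s.2).2.2.1
  have hbf : b * f = b := hb.le_of_forall fun s => (hS s s.2).2.2.2.1
  have hab : a * b = 0 := by
    rw [← hae, ← mul_eq_left_comm hb.sum_proj hf hbf, mul_assoc, mul_mul_of_eq hef, zero_mul,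
      mul_zero]
  have hequiv : ProjEquiv a b :=
    ProjEquiv.sum_of_orthogonal ha hb hab fun s => (hS s s.2).2.2.2.2
  have hea := isStarProjection_sub ha.sum_proj he hae
  have hfb := isStarProjection_sub hb.sum_proj hf hbf
  -- Otherwise the two remainders would contain equivalent nonzero subprojections, a further pair
  -- contradicting maximality.
  have hann : ∀ y, (e - a) * (y * (f - b)) = 0 := by
    intro y
    by_contra hne
    obtain ⟨a', b', ha', ha0, hle, hle', hab'⟩ := exists_equiv_subprojections hea hfb hne
    have hb' := hab'.proj_right ha'
    have e₁ : a' * a = 0 := by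
      rw [← hle, mul_assoc, sub_mul, mul_eq_left_comm ha.sum_proj he hae,
        IsStarProjection.mul_self ha.sum_proj, sub_self, mul_zero]
    have e₂ : b' * b = 0 := by
      rw [← hle', mul_assoc, sub_mul, mul_eq_left_comm hb.sum_proj hf hbf,
        IsStarProjection.mul_self hb.sum_proj, sub_self, mul_zero]
    have e₃ : ∀ s ∈ S, a' * s.1 = 0 := fun s hs => by
      rw [← ha.le' ⟨s, hs⟩, ← mul_assoc, e₁, zero_mul]
    have e₄ : ∀ s ∈ S, b' * s.2 = 0 := fun s hs => by
      rw [← hb.le' ⟨s, hs⟩, ← mul_assoc, e₂, zero_mul]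
    have hmem : (a', b') ∈ S := by
      refine hmax _ ⟨ha', ha0, ?_, ?_, hab'⟩ fun s hs => ⟨⟨e₃ s hs, e₄ s hs⟩,
        mul_eq_zero_comm ha' (hS s hs).1 (e₃ s hs), mul_eq_zero_comm hb' (hp₂ s hs) (e₄ s hs)⟩
      · change a' * e = a'
        rw [← hle, mul_assoc, sub_mul, IsStarProjection.mul_self he, hae]
      · change b' * f = b'
        rw [← hle', mul_assoc, sub_mul, IsStarProjection.mul_self hf, hbf]
    have := e₃ _ hmem
    rw [IsStarProjection.mul_self ha'] at this
    exact ha0 this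
  -- The central cover of `e - a` separates the remainders: `c` kills `f - b` and `1 - c` kills `e -
  -- a`.
  obtain ⟨c, hc, hce, hc0, -⟩ := exists_centralCover (e - a)
  have h₁ : c * f = c * b := by
    have := hc0 _ hann
    rwa [mul_sub, sub_eq_zero] at this
  have h₂ : (1 - c) * e = (1 - c) * a := by
    rw [← sub_eq_zero, ← mul_sub, sub_mul, one_mul, hce, sub_self]
  refine ⟨c, hc, ?_, ?_⟩
  · rw [h₁]
    exact SubEquiv.intro (hc.mul_proj hb.sum_proj) (hequiv.symm.central_mul hb.sum_proj hc)
      (by rw [hc.mul_mul, hae])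
  · rw [h₂]
    exact SubEquiv.intro (hc.one_sub.mul_proj ha.sum_proj)
      (hequiv.central_mul ha.sum_proj hc.one_sub) (by rw [hc.one_sub.mul_mul, hbf])

/-! ### Properly infinite projections: sums and absorption -/

/-- A projection that is zero or properly infinite. -/
def Doubled (e : A) : Prop := ∃ a b : A, IsStarProjection a ∧ IsStarProjection b ∧ a * b = 0 ∧
  a + b = e ∧ ProjEquiv a e ∧ ProjEquiv b e

omit [IsAWStarAlgebra A] in
-- Idempotency of `a + b` gives `ab = -ba`; multiplying by `a` on either side gives `ab = -aba =
-- ba`, so `2ab = 0`.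
theorem orthogonal_of_add {a b : A} (ha : IsStarProjection a) (hb : IsStarProjection b)
    (hab : IsStarProjection (a + b)) : a * b = 0 := by
  have ha' := IsStarProjection.mul_self ha
  have hb' := IsStarProjection.mul_self hb
  have h := IsStarProjection.mul_self hab
  simp only [mul_add, add_mul, ha', hb'] at h
  have h₁ : a * b + b * a = 0 := by
    have : a * b + b * a = (a + b * a + (a * b + b)) - (a + b) := by abel
    rw [this, h, sub_self]
  have h₂ : a * b = -(b * a) := eq_neg_of_add_eq_zero_left h₁
  have h₃ : a * b = a * b * a * (-1) := by
    calc a * b = a * (a * b) := by rw [mul_mul_of_eq ha']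
      _ = a * -(b * a) := by rw [h₂]
      _ = a * b * a * (-1) := by simp [mul_assoc]
  have h₄ : b * a = a * b * a * (-1) := by
    calc b * a = b * a * a := by rw [mul_assoc, ha']
      _ = a * b * a * (-1) := by rw [h₂]; simp
  have h₅ : (2 : ℂ) • (a * b) = 0 := by
    rw [two_smul]
    nth_rw 2 [h₃]
    rw [← h₄, h₁]
  exact (smul_eq_zero.mp h₅).resolve_left two_ne_zero

namespace Doubled

variable {e f z : A}

omit [IsAWStarAlgebra A] in
theorem proj (h : Doubled e) : IsStarProjection e := by
  obtain ⟨a, b, ha, hb, hab, rfl, -⟩ := h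
  exact isStarProjection_add ha hb hab

omit [IsAWStarAlgebra A] in
theorem isProperlyInfinite (h : Doubled e) (he : e ≠ 0) : IsProperlyInfinite e := by
  have := h.proj
  obtain ⟨a, b, ha, hb, hab, hs, h₁, h₂⟩ := h
  exact ⟨this, he, a, b, ha, hb, h₁.trans ha h₂.symm, h₂, hs.symm⟩

omit [IsAWStarAlgebra A] in
theorem of_isProperlyInfinite (h : IsProperlyInfinite e) : Doubled e := by
  obtain ⟨he, -, a, b, ha, hb, h₁, h₂, rfl⟩ := h
  exact ⟨a, b, ha, hb, orthogonal_of_add ha hb he, rfl, h₁.trans ha h₂, h₂⟩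

/-- The projection `e - b` dominates `a`, so `e` embeds in both `e - b` and `b`; Schröder–Bernstein
makes both equivalent to `e`. -/
theorem of_subEquiv {a b : A} (he : IsStarProjection e) (ha : IsStarProjection a)
    (hb : IsStarProjection b) (hae : a * e = a) (hbe : b * e = b) (hab : a * b = 0)
    (h₁ : SubEquiv e a) (h₂ : SubEquiv e b) : Doubled e := by
  have heb := isStarProjection_sub hb he hbe
  have haeb : a * (e - b) = a := by rw [mul_sub, hae, hab, sub_zero]
  refine ⟨e - b, b, heb, hb, ?_, by abel, ?_, ?_⟩
  · rw [sub_mul, mul_eq_left_comm hb he hbe, IsStarProjection.mul_self hb, sub_self]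
  · refine SubEquiv.antisymm heb he (.of_le heb ?_) (h₁.trans he (.of_le ha haeb))
    rw [sub_mul, hbe, IsStarProjection.mul_self he]
  · exact SubEquiv.antisymm hb he (.of_le hb hbe) h₂

omit [IsAWStarAlgebra A] in
theorem central_mul (h : Doubled e) (hz : IsCentralProj z) : Doubled (z * e) := by
  obtain ⟨a, b, ha, hb, hab, rfl, h₁, h₂⟩ := h
  exact ⟨z * a, z * b, hz.mul_proj ha, hz.mul_proj hb, by rw [hz.mul_mul, hab, mul_zero],
    by rw [mul_add], h₁.central_mul ha hz, h₂.central_mul hb hz⟩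

omit [IsAWStarAlgebra A] in
theorem equiv (h : Doubled e) (hef : ProjEquiv e f) : Doubled f := by
  obtain ⟨v, hv⟩ := hef.symm.exists_implements (hef.proj_right h.proj)
  have he := h.proj
  obtain ⟨a, b, ha, hb, hab, rfl, h₁, h₂⟩ := h
  have hae : a * (a + b) = a := by rw [mul_add, hab, add_zero, IsStarProjection.mul_self ha]
  have hbe : b * (a + b) = b := by
    rw [mul_add, mul_eq_zero_comm ha hb hab, zero_add, IsStarProjection.mul_self hb]
  have ha' := hv.restrict ha hae
  have hb' := hv.restrict hb hbe
  refine ⟨v * a * star v, v * b * star v, ha'.proj_left, hb'.proj_left, ?_, ?_,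
    (ha'.projEquiv.trans ha'.proj_left h₁).trans ha'.proj_left hef,
    (hb'.projEquiv.trans hb'.proj_left h₂).trans hb'.proj_left hef⟩
  · simp only [mul_assoc]
    rw [mul_mul_of_eq hv.star_mul, mul_mul_of_eq hae, mul_mul_of_eq hab, zero_mul, mul_zero]
  · rw [← add_mul, ← mul_add, hv.right, hv.mul_star]

/-- Orthogonal sums of properly infinite projections are properly infinite. -/
theorem sum {ι : Type*} {p : ι → A} (h : IsSum p e) (hp : ∀ i, Doubled (p i)) : Doubled e := by
  -- Equivalences can so far be summed only between orthogonal projections. With three copies of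
  -- each term, every comparison below is between orthogonal sums: two thirds against the remaining
  -- one, or one third against another.
  have hthird : ∀ i, ∃ a b c : A, IsStarProjection a ∧ IsStarProjection b ∧ IsStarProjection c ∧
      a * b = 0 ∧ a * c = 0 ∧ b * c = 0 ∧ a + b + c = p i ∧ ProjEquiv a (p i) ∧
      ProjEquiv b (p i) ∧ ProjEquiv c (p i) ∧ ProjEquiv (b + c) (p i) ∧
      ProjEquiv (a + b) (p i) := by
    intro i
    obtain ⟨x, c, hx, hc, hxc, hs, h₁, h₂⟩ := hp i
    obtain ⟨a, b, ha, hb, hab, rfl, h₃, h₄⟩ := equiv (hp i) h₁.symm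
    have hac : a * c = 0 := by
      rw [← mul_zero a, ← hxc, add_mul, mul_add, mul_mul_of_eq (IsStarProjection.mul_self ha),
        mul_mul_of_eq hab, zero_mul, add_zero]
    have hbc : b * c = 0 := by rwa [add_mul, hac, zero_add] at hxc
    have h₅ := h₃.trans ha h₁
    have h₆ := h₄.trans hb h₁
    refine ⟨a, b, c, ha, hb, hc, hab, hac, hbc, hs, h₅, h₆, h₂, ?_, h₁⟩
    rw [add_comm]
    have := ProjEquiv.add hc hb (h₂.trans hc h₅.symm) (.refl hb) (mul_eq_zero_comm hb hc hbc) hab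
    exact this.trans (isStarProjection_add hc hb (mul_eq_zero_comm hb hc hbc)) h₁
  choose a b c ha hb hc hab hac hbc hs h₁ h₂ h₃ h₄ h₅ using hthird
  have hap : ∀ i, a i * p i = a i := fun i => by
    rw [← hs, mul_add, mul_add, hab, hac, IsStarProjection.mul_self (ha i), add_zero, add_zero]
  have hbp : ∀ i, b i * p i = b i := fun i => by
    rw [← hs, mul_add, mul_add, mul_eq_zero_comm (ha i) (hb i) (hab i), hbc,
      IsStarProjection.mul_self (hb i), add_zero, zero_add]
  have hcp : ∀ i, c i * p i = c i := fun i => by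
    rw [← hs, mul_add, mul_add, mul_eq_zero_comm (ha i) (hc i) (hac i),
      mul_eq_zero_comm (hb i) (hc i) (hbc i),
      IsStarProjection.mul_self (hc i), add_zero, zero_add]
  have cross : ∀ {x y : ι → A}, (∀ i, x i * p i = x i) → (∀ i, y i * p i = y i) →
      (∀ i, IsStarProjection (y i)) → ∀ i j, i ≠ j → x i * y j = 0 := by
    intro x y hx hy hy' i j hij
    rw [← hx i, ← mul_eq_left_comm (hy' j) (h.proj j) (hy j), mul_assoc,
      mul_mul_of_eq (h.orth i j hij), zero_mul, mul_zero]
  have cross' : ∀ {x y : ι → A}, (∀ i, x i * p i = x i) → (∀ i, y i * p i = y i) →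
      (∀ i, IsStarProjection (y i)) → (∀ i, x i * y i = 0) → ∀ i j, x i * y j = 0 := by
    intro x y hx hy hy' hxy i j
    by_cases hij : i = j
    · rw [hij, hxy]
    · exact cross hx hy hy' i j hij
  obtain ⟨sa, hsa⟩ := exists_isSum ha (cross hap hap ha)
  obtain ⟨sb, hsb⟩ := exists_isSum hb (cross hbp hbp hb)
  obtain ⟨sc, hsc⟩ := exists_isSum hc (cross hcp hcp hc)
  have hac' := cross' hap hcp hc hac
  have hbc' := cross' hbp hcp hc hbc
  have hsab := hsa.add hsb (cross' hap hbp hb hab)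
  have hsbc := hsb.add hsc hbc'
  have hsabc := hsab.add hsc (fun i j => by rw [add_mul, hac', hbc', add_zero])
  have hAB := hsa.mul_eq_zero hsb (cross' hap hbp hb hab)
  have hAC := hsa.mul_eq_zero hsc hac'
  have hBC := hsb.mul_eq_zero hsc hbc'
  have hsum : sa + sb + sc = e := by
    refine IsSum.unique hsabc ?_
    simpa only [hs] using h
  have e₁ : ProjEquiv (sa + sb) sc := ProjEquiv.sum_of_orthogonal hsab hsc
    (by rw [add_mul, hAC, hBC, add_zero])
    fun i => (h₅ i).trans (hsab.proj i) (h₃ i).symm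
  have e₂ : ProjEquiv sb sa := ProjEquiv.sum_of_orthogonal hsb hsa
    (mul_eq_zero_comm hsa.sum_proj hsb.sum_proj hAB) fun i => (h₂ i).trans (hb i) (h₁ i).symm
  have e₃ : ProjEquiv sc sb := ProjEquiv.sum_of_orthogonal hsc hsb
    (mul_eq_zero_comm hsb.sum_proj hsc.sum_proj hBC) fun i => (h₃ i).trans (hc i) (h₂ i).symm
  have e₄ : ProjEquiv (sb + sc) sa := ProjEquiv.sum_of_orthogonal hsbc hsa
    (mul_eq_zero_comm hsa.sum_proj hsbc.sum_proj (by rw [mul_add, hAB, hAC, add_zero]))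
    fun i => (h₄ i).trans (hsbc.proj i) (h₁ i).symm
  have e₅ : ProjEquiv (sa + sb + sc) (sc + sb) :=
    ProjEquiv.add hsab.sum_proj hsc.sum_proj e₁ e₃ (by rw [add_mul, hAC, hBC, add_zero])
      (mul_eq_zero_comm hsb.sum_proj hsc.sum_proj hBC)
  rw [hsum, add_comm sc sb] at e₅
  have e₆ := e₅.trans h.sum_proj e₄
  refine of_subEquiv h.sum_proj hsa.sum_proj hsb.sum_proj ?_ ?_ hAB (.of_equiv h.sum_proj e₆)
    (.of_equiv h.sum_proj (e₆.trans h.sum_proj e₂.symm))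
  · rw [← hsum, mul_add, mul_add, IsStarProjection.mul_self hsa.sum_proj, hAB, hAC, add_zero,
      add_zero]
  · rw [← hsum, mul_add, mul_add, IsStarProjection.mul_self hsb.sum_proj, hBC,
      mul_eq_zero_comm hsa.sum_proj hsb.sum_proj hAB, add_zero, zero_add]

omit [IsAWStarAlgebra A] in
theorem exists_halves (h : Doubled e) : ∃ a b : A, IsStarProjection a ∧ IsStarProjection b ∧
    a * b = 0 ∧ a + b = e ∧ a * e = a ∧ b * e = b ∧ ProjEquiv a e ∧ ProjEquiv b e := by
  obtain ⟨a, b, ha, hb, hab, rfl, h₁, h₂⟩ := h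
  refine ⟨a, b, ha, hb, hab, rfl, ?_, ?_, h₁, h₂⟩
  · rw [mul_add, hab, add_zero, IsStarProjection.mul_self ha]
  · rw [mul_add, mul_eq_zero_comm ha hb hab, zero_add, IsStarProjection.mul_self hb]

/-- The sum `e + r` embeds in `e`, with `e` going into one half and `r` into the other. -/
theorem absorb {r : A} (h : Doubled e) (hr : IsStarProjection r) (her : e * r = 0)
    (hre : SubEquiv r e) : Doubled (e + r) ∧ ProjEquiv (e + r) e := by
  have he := h.proj
  have hs := isStarProjection_add he hr her
  have hes : e * (e + r) = e := by rw [mul_add, her, add_zero, IsStarProjection.mul_self he]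
  obtain ⟨a, b, ha, hb, hab, hs', hae, hbe, h₁, h₂⟩ := h.exists_halves
  have h₃ : SubEquiv (e + r) e := by
    rw [← hs']
    rw [hs']
    nth_rw 2 [← hs']
    exact .add he hr ha hb (.of_equiv he h₁.symm) (hre.trans hr (.of_equiv he h₂.symm)) her hab
  refine ⟨of_subEquiv hs ha hb ?_ ?_ hab (h₃.trans hs (.of_equiv he h₁.symm))
    (h₃.trans hs (.of_equiv he h₂.symm)), SubEquiv.antisymm hs he h₃ (.of_le he hes)⟩
  · rw [← hae, mul_assoc, hes]
  · rw [← hbe, mul_assoc, hes]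

end Doubled

/-! ### Exhaustion, central partitions and comparability -/

/-- A projection `q ≿ p ≠ 0` is exhausted by copies of `p`, up to a remainder which is small on
some central summand meeting `p`. -/
theorem exists_exhaustion {p q : A} (hp : IsStarProjection p) (hp0 : p ≠ 0)
    (hq : IsStarProjection q) (hpq : SubEquiv p q) :
    ∃ (ι : Type u) (_ : Nonempty ι) (P : ι → A) (D : A), IsSum P D ∧ D * q = D ∧
      (∀ i, ProjEquiv p (P i)) ∧
      ∃ z : A, IsCentralProj z ∧ z * p ≠ 0 ∧ SubEquiv (z * (q - D)) (z * D) := by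
  obtain ⟨S, hS, hpw, hmax⟩ := exists_maximal_pairwise
    (fun a : A => ProjEquiv p a ∧ a * q = a) (fun a b => a * b = 0)
  have hproj : ∀ s ∈ S, IsStarProjection s := fun s hs => (hS s hs).1.proj_right hp
  have hne : S.Nonempty := by
    by_contra hne
    rw [Set.not_nonempty_iff_eq_empty] at hne
    obtain ⟨a, ha, hpa, haq⟩ := hpq
    have := hmax a ⟨hpa, Eq.symm haq⟩ (by simp [hne])
    simp [hne] at this
  obtain ⟨p₀, hp₀⟩ := hne
  obtain ⟨D, hD⟩ := exists_isSum (p := fun s : S => s.1) (fun s => hproj s s.2)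
    (fun s t hst => hpw s.2 t.2 (Subtype.coe_injective.ne hst))
  have hDq : D * q = D := hD.le_of_forall fun s => (hS s s.2).2
  have hr := isStarProjection_sub hD.sum_proj hq hDq
  have hpD : p₀ * D = p₀ := hD.le ⟨p₀, hp₀⟩
  have hpr : p₀ * (q - D) = 0 := by rw [mul_sub, (hS p₀ hp₀).2, hpD, sub_self]
  obtain ⟨z, hz, h₁, h₂⟩ := comparability_of_orthogonal (hproj _ hp₀) hr hpr
  refine ⟨S, ⟨⟨p₀, hp₀⟩⟩, fun s => s.1, D, hD, hDq, fun s => (hS s s.2).1, z, hz, fun hzp => ?_,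
    h₁.trans (hz.mul_proj hr)
      (.of_le (hz.mul_proj (hproj _ hp₀)) (by rw [hz.mul_mul, hpD]))⟩
  -- If `z` missed `p`, comparability would place all of `p₀` inside the remainder `q - D`, and this
  -- further copy of `p` would contradict maximality.
  have hzp₀ : z * p₀ = 0 :=
    (((hS p₀ hp₀).1.central_mul hp hz).symm).eq_zero hzp
  rw [sub_mul, sub_mul, one_mul, one_mul, hzp₀, sub_zero] at h₂
  obtain ⟨a, ha, hpa, hle⟩ := h₂
  have hpa' := (hS p₀ hp₀).1.trans hp hpa
  have hle' : a * ((q - D) - z * (q - D)) = a := Eq.symm hle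
  have har : a * (q - D) = a := by
    rw [← hle', mul_assoc, sub_mul, mul_assoc, IsStarProjection.mul_self hr]
  have haD : a * D = 0 := by
    rw [← har, mul_assoc, sub_mul, mul_eq_left_comm hD.sum_proj hq hDq,
      IsStarProjection.mul_self hD.sum_proj, sub_self, mul_zero]
  have haS : ∀ s ∈ S, a * s = 0 := fun s hs => by
    have : D * s = s := hD.le' ⟨s, hs⟩
    rw [← this, ← mul_assoc, haD, zero_mul]
  have hmem := hmax a ⟨hpa', by
    rw [← har, mul_assoc, sub_mul, IsStarProjection.mul_self hq, hDq]⟩ fun s hs =>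
    ⟨haS s hs, mul_eq_zero_comm ha (hproj s hs) (haS s hs)⟩
  have := haS a hmem
  rw [IsStarProjection.mul_self ha] at this
  exact hpa'.ne_zero hp0 this

/-- A maximal orthogonal family of central projections below `c` with a given property. -/
theorem exists_central_family (Q : A → Prop) (c : A) :
    ∃ (ι : Type u) (Z : ι → A) (s : A), IsSum Z s ∧ IsCentralProj s ∧ s * c = s ∧
      (∀ i, IsCentralProj (Z i) ∧ Q (Z i)) ∧
      ∀ w, IsCentralProj w → w * c = w → w * s = 0 → Q w → w = 0 := by
  obtain ⟨S, hS, hpw, hmax⟩ := exists_maximal_pairwise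
    (fun a : A => IsCentralProj a ∧ a * c = a ∧ Q a) (fun a b => a * b = 0)
  obtain ⟨s, hs⟩ := exists_isSum (p := fun s : S => s.1) (fun s => (hS s s.2).1.1)
    (fun s t hst => hpw s.2 t.2 (Subtype.coe_injective.ne hst))
  refine ⟨S, fun s => s.1, s, hs, hs.isCentralProj fun i => (hS i i.2).1,
    hs.le_of_forall fun i => (hS i i.2).2.1, fun i => ⟨(hS i i.2).1, (hS i i.2).2.2⟩,
    fun w hw hwc hws hQ => ?_⟩
  have h₁ : ∀ t ∈ S, w * t = 0 := fun t ht => by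
    have : s * t = t := hs.le' ⟨t, ht⟩
    rw [← this, ← mul_assoc, hws, zero_mul]
  have := h₁ w (hmax w ⟨hw, hwc, hQ⟩ fun t ht =>
    ⟨h₁ t ht, mul_eq_zero_comm hw.1 (hS t ht).1.1 (h₁ t ht)⟩)
  rwa [hw.mul_self] at this

/-- A central projection is partitioned into central projections with a property that occurs
below each of its nonzero central subprojections. -/
theorem exists_central_partition (Q : A → Prop) {c : A} (hc : IsCentralProj c)
    (h : ∀ w, IsCentralProj w → w * c = w → w ≠ 0 →
      ∃ z, IsCentralProj z ∧ z * w = z ∧ z ≠ 0 ∧ Q z) :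
    ∃ (ι : Type u) (Z : ι → A), IsSum Z c ∧ ∀ i, IsCentralProj (Z i) ∧ Q (Z i) := by
  obtain ⟨ι, Z, s, hs, hsc, hle, hQ, hmax⟩ := exists_central_family Q c
  suffices c - s = 0 by
    rw [sub_eq_zero.mp this]
    exact ⟨ι, Z, hs, hQ⟩
  by_contra hne
  have hw := hsc.sub hc hle
  have hcs : c * s = s := by rw [hc.comm, hle]
  obtain ⟨z, hz, hzw, hz0, hQz⟩ := h _ hw (by rw [sub_mul, hc.mul_self, hle]) hne
  refine hz0 (hmax z hz ?_ ?_ hQz)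
  · rw [← hzw, mul_assoc, sub_mul, hc.mul_self, hle]
  · rw [← hzw, mul_assoc, sub_mul, hcs, hsc.mul_self, sub_self, mul_zero]

namespace Doubled

variable {e f E : A}

/-- On some central summand, a projection `q ≿ p` is equivalent to an orthogonal sum of copies of
the properly infinite projection `p`. -/
theorem exists_exhaustion {p q : A} (h : Doubled p) (hp0 : p ≠ 0) (hq : IsStarProjection q)
    (hpq : SubEquiv p q) : ∃ (ι : Type u) (_ : Nonempty ι) (P : ι → A) (D : A), IsSum P D ∧
      D * q = D ∧ (∀ i, ProjEquiv p (P i)) ∧ Doubled D ∧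
      ∃ z : A, IsCentralProj z ∧ z * p ≠ 0 ∧ ProjEquiv (z * q) (z * D) := by
  obtain ⟨ι, hι, P, D, hD, hDq, hP, z, hz, hz0, hle⟩ :=
    AWStar.exists_exhaustion h.proj hp0 hq hpq
  have hd : Doubled D := .sum hD fun i => h.equiv (hP i)
  have := (hd.central_mul hz).absorb
    (hz.mul_proj (isStarProjection_sub hD.sum_proj hq hDq)) (by
      rw [hz.mul_mul, mul_sub, hDq, IsStarProjection.mul_self hD.sum_proj, sub_self, mul_zero])
    hle
  rw [← mul_add, add_sub_cancel] at this
  exact ⟨ι, hι, P, D, hD, hDq, hP, hd, z, hz, hz0, this.2⟩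

/-- The central cover of a properly infinite projection is properly infinite. -/
theorem centralCover {c : A} (h : Doubled e) (hc : IsCentralProj c)
    (hmin : ∀ z, IsCentralProj z → z * e = e → c * z = c) : Doubled c := by
  -- Every nonzero central `w ≤ c` meets `e`, and on some summand it is equivalent to a sum of
  -- copies of the properly infinite `we`.
  obtain ⟨ι, Z, hZ, hQ⟩ := exists_central_partition (fun z => Doubled z) hc (by
    intro w hw hwc hw0
    have hwe : w * e ≠ 0 := by
      intro hwe
      have := hmin (1 - w) hw.one_sub (by rw [sub_mul, hwe, one_mul, sub_zero])
      rw [mul_sub, mul_one, ← hw.comm, hwc, sub_eq_self] at this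
      exact hw0 this
    obtain ⟨κ, -, P, D, -, -, -, hD, z, hz, hz0, heq⟩ := (h.central_mul hw).exists_exhaustion hwe
      hw.1 (.of_le (hw.mul_proj h.proj) (by rw [← hw.comm, mul_mul_of_eq hw.mul_self]))
    exact ⟨z * w, hz.mul hw, by rw [mul_assoc, hw.mul_self],
      fun h0 => hz0 (by rw [← mul_assoc, h0, zero_mul]), (hD.central_mul hz).equiv heq.symm⟩)
  exact .sum hZ fun i => (hQ i).2

/-- Equivalence is additive below a properly infinite projection. -/
theorem sum_equiv {ι : Type*} {p q : ι → A} (hE : Doubled E) (hp : IsSum p e) (hq : IsSum q f)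
    (he : e * E = e) (hf : f * E = f) (h : ∀ i, ProjEquiv (p i) (q i)) : ProjEquiv e f := by
  obtain ⟨a, b, ha, hb, hab, -, haE, hbE, h₁, h₂⟩ := hE.exists_halves
  obtain ⟨v, hv⟩ := h₁.exists_implements ha
  obtain ⟨w, hw⟩ := h₂.exists_implements hb
  have hp' := hp.conj hv he
  have hq' := hq.conj hw hf
  have hpE : ∀ i, p i * E = p i := fun i => by rw [← hp.le i, mul_assoc, he]
  have hqE : ∀ i, q i * E = q i := fun i => by rw [← hq.le i, mul_assoc, hf]
  -- Moving `e` into one half of `E` and `f` into the other makes the two sums orthogonal.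
  have key : ProjEquiv (v * e * star v) (w * f * star w) := by
    refine ProjEquiv.sum_of_orthogonal hp' hq' ?_ fun i => ?_
    · rw [← hv.conj_le, mul_assoc _ a, ← hw.left]
      simp only [mul_assoc]
      rw [mul_mul_of_eq hab, zero_mul, mul_zero, mul_zero, mul_zero]
    · exact ((hv.restrict (hp.proj i) (hpE i)).projEquiv.trans (hp'.proj i) (h i)).trans (hp'.proj i)
        (hw.restrict (hq.proj i) (hqE i)).symm.projEquiv
  exact ((hv.restrict hp.sum_proj he).symm.projEquiv.trans hp.sum_proj key).trans hp.sum_proj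
    (hw.restrict hq.sum_proj hf).projEquiv

/-- Generalized comparability below a properly infinite projection. -/
theorem comparability (hE : Doubled E) (he : IsStarProjection e) (hf : IsStarProjection f)
    (heE : e * E = e) (hfE : f * E = f) : ∃ z : A, IsCentralProj z ∧ SubEquiv (z * e) (z * f) ∧
      SubEquiv ((1 - z) * f) ((1 - z) * e) := by
  obtain ⟨a, b, ha, hb, hab, -, haE, hbE, h₁, h₂⟩ := hE.exists_halves
  obtain ⟨v, hv⟩ := h₁.exists_implements ha
  obtain ⟨w, hw⟩ := h₂.exists_implements hb
  have he' := hv.restrict he heE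
  have hf' := hw.restrict hf hfE
  obtain ⟨z, hz, h₃, h₄⟩ := comparability_of_orthogonal hf'.proj_left he'.proj_left (by
    rw [← hw.conj_le, mul_assoc _ b, ← hv.left]
    simp only [mul_assoc]
    rw [mul_mul_of_eq (mul_eq_zero_comm ha hb hab), zero_mul, mul_zero, mul_zero, mul_zero])
  have tr : ∀ {z x x' y y' : A}, IsCentralProj z → IsStarProjection x' → IsStarProjection y →
      ProjEquiv x x' → ProjEquiv y y' → SubEquiv (z * x) (z * y) → SubEquiv (z * x') (z * y') := by
    intro z x x' y y' hz hx hy h h' hs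
    exact ((SubEquiv.of_equiv (hz.mul_proj hx) (h.symm.central_mul hx hz)).trans (hz.mul_proj hx)
      hs).trans (hz.mul_proj hx) (.of_equiv (hz.mul_proj hy) (h'.central_mul hy hz))
  exact ⟨z, hz, tr hz he hf'.proj_left he'.projEquiv hf'.projEquiv h₃,
    tr hz.one_sub hf he'.proj_left hf'.projEquiv he'.projEquiv h₄⟩

/-- Central additivity of subequivalence. -/
theorem subEquiv_of_partition {ι : Type*} {Z : ι → A} {c : A} (hc : Doubled c) (hZ : IsSum Z c)
    (hcent : ∀ i, IsCentralProj (Z i)) (he : IsStarProjection e) (hf : IsStarProjection f)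
    (h : ∀ i, SubEquiv (Z i * e) (Z i * f)) : SubEquiv (c * e) (c * f) := by
  have hcc := hZ.isCentralProj hcent
  have hse := hZ.mul_of_central hcent hcc he
  have hsf := hZ.mul_of_central hcent hcc hf
  choose g hg heg hgf using h
  have hgf' : ∀ i, g i * (Z i * f) = g i := fun i => Eq.symm (hgf i)
  obtain ⟨G, hG⟩ := exists_isSum hg fun i j hij => by
    rw [← hgf' i, ← mul_eq_left_comm (hg j) (hsf.proj j) (hgf' j), mul_assoc,
      mul_mul_of_eq (hsf.orth i j hij), zero_mul, mul_zero]
  have hGf : G * (c * f) = G := hG.le_of_forall fun i => by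
    rw [← hgf' i, mul_assoc, hsf.le i]
  refine .intro hse.sum_proj (hc.sum_equiv hse hG ?_ ?_ heg) hGf
  · rw [hcc.comm, mul_assoc, ← hcc.comm c, hcc.mul_self]
  · rw [← hGf, hcc.comm, mul_assoc, mul_assoc, hcc.mul_self]

end Doubled

/-! ### Packings and the dimension -/

/-- `f` contains an orthogonal family of copies of `e` indexed by `I`. -/
def Packs (e f : A) (I : Type u) : Prop :=
  ∃ p : I → A, (∀ i, ProjEquiv e (p i)) ∧ (∀ i, p i * f = p i) ∧ ∀ i j, i ≠ j → p i * p j = 0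

namespace Packs

variable {e f e' f' z E : A} {I J : Type u}

omit [IsAWStarAlgebra A] in
theorem mono (h : Packs e f I) (φ : J ↪ I) : Packs e f J := by
  obtain ⟨p, h₁, h₂, h₃⟩ := h
  exact ⟨p ∘ φ, fun i => h₁ _, fun i => h₂ _, fun i j hij => h₃ _ _ (φ.injective.ne hij)⟩

omit [IsAWStarAlgebra A] in
theorem mono_card (h : Packs e f I) (hJ : #J ≤ #I) : Packs e f J :=
  h.mono (Cardinal.le_def J I |>.mp hJ).some

omit [IsAWStarAlgebra A] in
theorem central_mul (he : IsStarProjection e) (h : Packs e f I) (hz : IsCentralProj z) :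
    Packs (z * e) (z * f) I := by
  obtain ⟨p, h₁, h₂, h₃⟩ := h
  exact ⟨fun i => z * p i, fun i => (h₁ i).central_mul he hz, fun i => by rw [hz.mul_mul, h₂],
    fun i j hij => by rw [hz.mul_mul, h₃ i j hij, mul_zero]⟩

omit [IsAWStarAlgebra A] in
theorem equiv (he : IsStarProjection e) (hf : IsStarProjection f) (h : Packs e f I)
    (hee : ProjEquiv e e') (hff : ProjEquiv f f') : Packs e' f' I := by
  obtain ⟨p, h₁, h₂, h₃⟩ := h
  obtain ⟨v, hv⟩ := hff.symm.exists_implements (hff.proj_right hf)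
  have hp : ∀ i, IsStarProjection (p i) := fun i => (h₁ i).proj_right he
  have he' := hee.proj_right he
  refine ⟨fun i => v * p i * star v, fun i => ?_, fun i => hv.conj_le, fun i j hij => ?_⟩
  · exact (hee.symm.trans he' (h₁ i)).trans he' (hv.restrict (hp i) (h₂ i)).symm.projEquiv
  · simp only [mul_assoc]
    rw [mul_mul_of_eq hv.star_mul, mul_mul_of_eq (h₂ i), mul_mul_of_eq (h₃ i j hij), zero_mul,
      mul_zero]

omit [IsAWStarAlgebra A] in
theorem self_equiv (he : IsStarProjection e) (h : Packs e e I) (hee : ProjEquiv e e') :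
    Packs e' e' I := h.equiv he he hee hee

/-- Packings of the terms of an orthogonal sum add up to a packing of the sum. -/
theorem sum {ι : Type*} {p : ι → A} (hE : Doubled E) (h : IsSum p e) (heE : e * E = e)
    (hp : ∀ i, Packs (p i) (p i) I) : Packs e e I := by
  choose q h₁ h₂ h₃ using hp
  have hq : ∀ i k, IsStarProjection (q i k) := fun i k => (h₁ i k).proj_right (h.proj i)
  have hcross : ∀ i j k l, i ≠ j → q i k * q j l = 0 := fun i j k l hij => by
    rw [← h₂ i k, ← mul_eq_left_comm (hq j l) (h.proj j) (h₂ j l), mul_assoc,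
      mul_mul_of_eq (h.orth i j hij), zero_mul, mul_zero]
  have hsum : ∀ k, ∃ s, IsSum (fun i => q i k) s := fun k =>
    exists_isSum (fun i => hq i k) fun i j hij => hcross i j k k hij
  choose s hs using hsum
  have hse : ∀ k, s k * e = s k := fun k => (hs k).le_of_forall fun i => by
    rw [← h₂ i k, mul_assoc, h.le]
  refine ⟨s, fun k => hE.sum_equiv h (hs k) heE (by rw [← hse, mul_assoc, heE]) fun i => h₁ i k,
    hse, fun k l hkl => (hs k).mul_eq_zero (hs l) fun i j => ?_⟩
  by_cases hij : i = j
  · subst hij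
    exact h₃ i k l hkl
  · exact hcross i j k l hij

/-- A packing can be completed to a member of `Γ(e)`. -/
theorem exists_memGamma [Nonempty I] (he : IsStarProjection e) (h : Packs e e I) :
    ∃ p : I → A, MemGamma e p := by
  classical
  obtain ⟨p, h₁, h₂, h₃⟩ := h
  have hp : ∀ i, IsStarProjection (p i) := fun i => (h₁ i).proj_right he
  obtain ⟨D, hD⟩ := exists_isSum hp h₃
  have hDe : D * e = D := hD.le_of_forall h₂
  have hr := isStarProjection_sub hD.sum_proj he hDe
  have hpr : ∀ i, p i * (e - D) = 0 := fun i => by rw [mul_sub, h₂, hD.le, sub_self]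
  have hrp : ∀ i, (e - D) * p i = 0 := fun i => mul_eq_zero_comm (hp i) hr (hpr i)
  have hre : (e - D) * e = e - D := by rw [sub_mul, IsStarProjection.mul_self he, hDe]
  obtain ⟨i₀⟩ := ‹Nonempty I›
  -- The remainder is added to a single term. That term still lies between `p i₀ ∼ e` and `e`, so it
  -- stays equivalent to `e`.
  set p' : I → A := Function.update p i₀ (p i₀ + (e - D)) with hp'
  have h0 : p' i₀ = p i₀ + (e - D) := Function.update_self ..
  have hi : ∀ i, i ≠ i₀ → p' i = p i := fun i hi => Function.update_of_ne hi ..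
  have hproj : ∀ i, IsStarProjection (p' i) := fun i => by
    by_cases h : i = i₀
    · rw [h, h0]; exact isStarProjection_add (hp _) hr (hpr _)
    · rw [hi i h]; exact hp i
  have hle : ∀ i, p' i * e = p' i := fun i => by
    by_cases h : i = i₀
    · rw [h, h0, add_mul, h₂, hre]
    · rw [hi i h, h₂]
  refine ⟨p', ⟨hproj, fun i j hij => ?_, he, fun i => (hle i).symm, fun q hq hpq => ?_⟩,
    fun i => ?_⟩
  · by_cases h : i = i₀
    · rw [h, h0, hi j (by rw [← h]; exact hij.symm), add_mul, h₃ _ _ (by rw [← h]; exact hij),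
        hrp, add_zero]
    · by_cases h' : j = i₀
      · rw [h', h0, hi i h, mul_add, h₃ _ _ h, hpr, add_zero]
      · rw [hi i h, hi j h', h₃ i j hij]
  · have h4 : ∀ i, p' i * (1 - q) = 0 := fun i => by
      rw [mul_sub, mul_one, sub_eq_zero]; exact hpq i
    have h5 : (e - D) * (1 - q) = 0 := by
      have := congrArg ((e - D) * ·) (h4 i₀)
      simp only [h0, mul_zero] at this
      rwa [← mul_assoc, mul_add, hrp, zero_add, IsStarProjection.mul_self hr] at this
    have h6 : D * (1 - q) = 0 := hD.ann _ fun i => by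
      by_cases h : i = i₀
      · have := h4 i₀
        rwa [h0, add_mul, h5, add_zero, ← h] at this
      · rw [← hi i h, h4]
    have h7 : e * (1 - q) = 0 := by
      rw [sub_mul, h6, sub_zero] at h5
      exact h5
    rw [mul_sub, mul_one, sub_eq_zero] at h7
    exact h7
  · by_cases h : i = i₀
    · subst h
      refine (ProjEquiv.of_sandwich he (hproj i) (hle i) ?_ (h₁ i)).symm
      rw [h0, mul_add, IsStarProjection.mul_self (hp i), hpr, add_zero]
    · rw [hi i h]
      exact (h₁ i).symm

omit [IsAWStarAlgebra A] in
theorem of_memGamma {p : I → A} (h : MemGamma e p) : Packs e e I :=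
  ⟨p, fun i => (h.2 i).symm, fun i => Eq.symm (h.1.le_sum i), h.1.orthogonal⟩

omit [IsAWStarAlgebra A] in
theorem card_le (he : IsStarProjection e) (he0 : e ≠ 0) (h : Packs e e I) : #I ≤ #A := by
  obtain ⟨p, h₁, h₂, h₃⟩ := h
  refine Cardinal.mk_le_of_injective (f := p) fun i j hij => ?_
  by_contra hne
  have := h₃ i j hne
  rw [hij, IsStarProjection.mul_self ((h₁ j).proj_right he)] at this
  exact (h₁ j).ne_zero he0 this

end Packs

omit [IsAWStarAlgebra A] in
-- For `e = a + b` and `v` carrying `e` onto `b`, the iterates `vⁿ a v*ⁿ` are orthogonal copies of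
-- `a ∼ e`.
theorem Doubled.packs_nat {e : A} (h : Doubled e) : Packs e e (ULift.{u} ℕ) := by
  obtain ⟨a, b, ha, hb, hab, -, hae, hbe, h₁, h₂⟩ := h.exists_halves
  obtain ⟨v, hv⟩ := h₂.exists_implements hb
  have := shift_implements hv hbe ha hae
  exact ⟨fun n => shift v a n.down, fun n => ((this n.down).2.trans
    ((this n.down).2.proj_left ha) h₁).symm, fun n => (this n.down).1, fun i j hij =>
    shift_orth hv hbe ha hae hab (fun h => hij (ULift.ext i j h))⟩

omit [IsAWStarAlgebra A] in
theorem Doubled.packs_finite {e : A} (h : Doubled e) (I : Type u) [Finite I] : Packs e e I :=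
  h.packs_nat.mono_card (by simp)

/-- The dimension bounds exactly the sizes of packings. -/
theorem mk_lt_dim_iff {e : A} (he : IsStarProjection e) (he0 : e ≠ 0) {I : Type u} :
    #I < dim e ↔ Packs e e I := by
  rw [dim, if_neg he0]
  have hne : {κ : Cardinal.{u} | ∀ (I : Type u) (p : I → A), MemGamma e p → #I < κ}.Nonempty :=
    ⟨Order.succ #A, fun I p hp => Order.lt_succ_of_le ((Packs.of_memGamma hp).card_le he he0)⟩
  constructor
  · intro h
    have : #I ∉ {κ : Cardinal.{u} | ∀ (I : Type u) (p : I → A), MemGamma e p → #I < κ} :=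
      notMem_of_lt_csInf' h
    simp only [Set.mem_ofPred_eq, not_forall, not_lt] at this
    obtain ⟨J, p, hp, hJ⟩ := this
    exact (Packs.of_memGamma hp).mono_card hJ
  · intro h
    cases isEmpty_or_nonempty I
    · rw [Cardinal.mk_eq_zero]
      -- The empty family does not sum to `e ≠ 0`; positivity of the dimension comes from the family
      -- with single term `e`.
      have := csInf_mem hne PUnit (fun _ => e)
        ⟨⟨fun _ => he, fun i j hij => (hij rfl).elim, he, fun _ => (IsStarProjection.mul_self he).symm,
          fun q _ hq => hq ⟨⟩⟩, fun _ => .refl he⟩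
      exact zero_le.trans_lt this
    · obtain ⟨p, hp⟩ := h.exists_memGamma he
      exact csInf_mem hne I p hp

theorem dim_le_of_packs {e : A} (he : IsStarProjection e) (he0 : e ≠ 0) {κ : Cardinal.{u}}
    (h : ∀ I : Type u, Packs e e I → #I < κ) : dim e ≤ κ := by
  refine le_of_forall_lt fun μ hμ => ?_
  induction μ using Cardinal.inductionOn with
  | _ I => exact h I ((mk_lt_dim_iff he he0).mp hμ)

/-- Multiplying a packing of `e` by `w` gives a packing of `we`, so cutting down centrally can only
raise the dimension. -/
theorem dim_le_dim_central_mul {e w : A} (he : IsStarProjection e) (hw : IsCentralProj w)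
    (h0 : w * e ≠ 0) : dim e ≤ dim (w * e) :=
  dim_le_of_packs he (fun h => h0 (by rw [h, mul_zero])) fun _ hI =>
    (mk_lt_dim_iff (hw.mul_proj he) h0).mpr (hI.central_mul he hw)

namespace Doubled

variable {e p q E : A}

theorem dim_pos (h : Doubled e) (he0 : e ≠ 0) : 0 < dim e := by
  have := (mk_lt_dim_iff h.proj he0).mpr (h.packs_finite PEmpty)
  rwa [Cardinal.mk_eq_zero] at this

/-- Monotonicity of the dimension on projections whose dimension does not grow under central
cut-downs. -/
theorem dim_le_of_subEquiv (hE : Doubled E) (hp : Doubled p) (hp0 : p ≠ 0)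
    (hq : IsStarProjection q) (hqE : q * E = q) (hpq : SubEquiv p q)
    (hdim : ∀ z, IsCentralProj z → z * q ≠ 0 → dim (z * q) ≤ dim q) : dim p ≤ dim q := by
  obtain ⟨ι, ⟨i₀⟩, P, D, hD, hDq, hP, -, z, hz, hz0, heq⟩ := hp.exists_exhaustion hp0 hq hpq
  have hzD := hD.central_mul hz
  have hzP : ∀ i, ProjEquiv (z * p) (z * P i) := fun i => (hP i).central_mul hp.proj hz
  have hzq0 : z * q ≠ 0 := heq.symm.ne_zero (hzD.ne_zero ((hzP i₀).ne_zero hz0))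
  refine (dim_le_of_packs hp.proj hp0 fun I hI => ?_).trans (hdim z hz hzq0)
  refine (mk_lt_dim_iff (hz.mul_proj hq) hzq0).mpr (Packs.self_equiv hzD.sum_proj ?_ heq.symm)
  refine .sum hE hzD ?_ fun i =>
    (hI.central_mul hp.proj hz).self_equiv (hz.mul_proj hp.proj) (hzP i)
  rw [← hDq, mul_assoc, mul_assoc, hqE]

/-- If `p ≾ q` and the dimension of `q` is not larger than that of `p`, then `q ≾ p` on some
central summand. -/
theorem exists_central_subEquiv (hE : Doubled E) (hp : Doubled p) (hp0 : p ≠ 0) (hpE : p * E = p)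
    (hq : IsStarProjection q) (hqE : q * E = q) (hpq : SubEquiv p q) (hle : dim q ≤ dim p)
    (hdim : ∀ z, IsCentralProj z → z * q ≠ 0 → dim (z * q) ≤ dim q) :
    ∃ z, IsCentralProj z ∧ z * p ≠ 0 ∧ SubEquiv (z * q) (z * p) := by
  obtain ⟨ι, ⟨i₀⟩, P, D, hD, hDq, hP, -, z, hz, hz0, heq⟩ := hp.exists_exhaustion hp0 hq hpq
  have hzp := hz.mul_proj hp.proj
  have hzD := hD.central_mul hz
  have hzP : ∀ i, ProjEquiv (z * p) (z * P i) := fun i => (hP i).central_mul hp.proj hz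
  have hzq0 : z * q ≠ 0 := heq.symm.ne_zero (hzD.ne_zero ((hzP i₀).ne_zero hz0))
  have hzDE : z * D * E = z * D := by rw [← hDq, mul_assoc, mul_assoc, hqE]
  refine ⟨z, hz, hz0, ?_⟩
  have hpack : Packs p p ι := by
    cases finite_or_infinite ι
    · exact hp.packs_finite ι
    -- Regrouping the copies of `zp` in `zD` into `ι` blocks of `ι` copies each shows that `zD`
    -- packs `ι` copies of itself.
    obtain ⟨σ⟩ : Nonempty (ι × ι ≃ ι) := Cardinal.eq.mp (by
      rw [← Cardinal.mul_def, Cardinal.mul_eq_self (Cardinal.aleph0_le_mk ι)])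
    have hQ := hzD.reindex σ
    have hsum : ∀ i, ∃ s, IsSum (fun j => z * P (σ (i, j))) s := fun i =>
      exists_isSum (fun j => hzD.proj _) fun j k hjk =>
        hzD.orth _ _ (σ.injective.ne fun h => hjk (congrArg Prod.snd h))
    choose s hs using hsum
    have hsD : ∀ i, s i * (z * D) = s i := fun i => (hs i).le_of_forall fun j => hzD.le _
    have : Packs (z * D) (z * D) ι := by
      refine ⟨s, fun i => hE.sum_equiv hzD (hs i) hzDE (by rw [← hsD, mul_assoc, hzDE]) fun j =>
        (hzP j).symm.trans (hzD.proj j) (hzP _), hsD, fun i j hij => ?_⟩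
      exact (hs i).mul_eq_zero (hs j) fun k l =>
        hzD.orth _ _ (σ.injective.ne fun h => hij (congrArg Prod.fst h))
    refine (mk_lt_dim_iff hp.proj hp0).mp (lt_of_lt_of_le ?_ ((hdim z hz hzq0).trans hle))
    exact (mk_lt_dim_iff (hz.mul_proj hq) hzq0).mpr (this.self_equiv hzD.sum_proj heq.symm)
  obtain ⟨p', h₁, h₂, h₃⟩ := hpack.central_mul hp.proj hz
  obtain ⟨S, hS⟩ := exists_isSum (fun i => (h₁ i).proj_right hzp) h₃
  have hSp : S * (z * p) = S := hS.le_of_forall h₂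
  refine .intro (hz.mul_proj hq) (heq.trans (hz.mul_proj hq) ?_) hSp
  refine hE.sum_equiv hzD hS hzDE ?_ fun i => (hzP i).symm.trans (hzD.proj i) (h₁ i)
  rw [← hSp, mul_assoc, mul_assoc, hpE]

/-- Dimension bounds pass to central sums. -/
theorem lt_dim_of_central_sum {ι : Type u} {Z : ι → A} {s : A} {κ : Cardinal.{u}}
    (hE : Doubled E) (he : IsStarProjection e) (heE : e * E = e) (hZ : IsSum Z s)
    (hcent : ∀ i, IsCentralProj (Z i)) (h : ∀ i, Z i * e ≠ 0 ∧ κ < dim (Z i * e))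
    (h0 : s * e ≠ 0) : κ < dim (s * e) := by
  have hs := hZ.isCentralProj hcent
  induction κ using Cardinal.inductionOn with
  | _ I =>
    refine (mk_lt_dim_iff (hs.mul_proj he) h0).mpr
      (.sum hE (hZ.mul_of_central hcent hs he) (by rw [mul_assoc, heE]) fun i => ?_)
    exact (mk_lt_dim_iff ((hcent i).mul_proj he) (h i).1).mp (h i).2

/-- Every central summand meeting `e` contains one on which the dimension of `e` is constant. -/
theorem exists_constant_dim {w : A} (hE : Doubled E) (he : IsStarProjection e) (heE : e * E = e)
    (hw : IsCentralProj w) (h0 : w * e ≠ 0) : ∃ z, IsCentralProj z ∧ z * w = z ∧ z * e ≠ 0 ∧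
      ∀ y, IsCentralProj y → y * (z * e) ≠ 0 → dim (y * (z * e)) = dim (z * e) := by
  -- The projection `s` collects the part of `w` where the dimension exceeds `d(we)`. Were `se` all
  -- of `we`, adding up packings would give `d(we) < d(we)`; so something remains over `w - s`,
  -- where no further jump is possible.
  obtain ⟨ι, Z, s, hZ, hs, hsw, hQ, hmax⟩ :=
    exists_central_family (fun z => z * e ≠ 0 ∧ dim (w * e) < dim (z * e)) w
  have hws : w * s = s := by rw [hw.comm, hsw]
  have hz := hs.sub hw hsw
  have hz0 : (w - s) * e ≠ 0 := by
    intro h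
    rw [sub_mul, sub_eq_zero] at h
    have := hE.lt_dim_of_central_sum he heE hZ (fun i => (hQ i).1) (fun i => (hQ i).2) (h ▸ h0)
    rw [h] at this
    exact lt_irrefl _ this
  have key : ∀ y, IsCentralProj y → y * ((w - s) * e) ≠ 0 →
      dim (y * ((w - s) * e)) = dim (w * e) := by
    intro y hy hy0
    refine le_antisymm (not_lt.mp fun hlt => hy0 ?_) ?_
    · rw [← mul_assoc] at hlt hy0 ⊢
      rw [hmax _ (hy.mul hz) ?_ ?_ ⟨hy0, hlt⟩, zero_mul]
      · rw [mul_assoc, sub_mul, hw.mul_self, hsw]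
      · rw [mul_assoc, sub_mul, hws, hs.mul_self, sub_self, mul_zero]
    · have h₁ : y * ((w - s) * e) = y * (w - s) * (w * e) := by
        rw [mul_assoc y, ← mul_assoc (w - s), sub_mul w s w, hw.mul_self, hsw]
      rw [h₁] at hy0 ⊢
      exact dim_le_dim_central_mul (hw.mul_proj he) (hy.mul hz) hy0
  refine ⟨w - s, hz, by rw [sub_mul, hw.mul_self, hsw], hz0, fun y hy hy0 => ?_⟩
  rw [key y hy hy0, ← key 1 .one (by rwa [one_mul]), one_mul]

end Doubled

/-! ### Central covers and equidimensional summands -/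

theorem exists_isCentralCover (e : A) : ∃ c, IsCentralCover e c := by
  obtain ⟨c, hc, h₁, -, h₂⟩ := exists_centralCover e
  refine ⟨c, hc, ?_, fun z hz hez => (h₂ z hz ?_).symm⟩
  · rw [ProjLE, ← hc.comm, h₁]
  · rw [hz.comm]; exact hez.symm

namespace IsCentralCover

variable {e c d z : A}

omit [IsAWStarAlgebra A] in
theorem mul_eq (h : IsCentralCover e c) : c * e = e := by
  rw [h.1.comm]; exact h.2.1.symm

omit [IsAWStarAlgebra A] in
theorem unique (h : IsCentralCover e c) (h' : IsCentralCover e d) : c = d := by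
  have h₁ : c = c * d := h.2.2 d h'.1 h'.2.1
  have h₂ : d = d * c := h'.2.2 c h.1 h.2.1
  rw [h₁, h.1.comm, ← h₂]

omit [IsAWStarAlgebra A] in
theorem le_of_mul_eq (h : IsCentralCover e c) (hz : IsCentralProj z) (hze : z * e = e) :
    c * z = c := (h.2.2 z hz (by rw [ProjLE, ← hz.comm, hze])).symm

omit [IsAWStarAlgebra A] in
theorem mul_ne_zero_iff (h : IsCentralCover e c) (hz : IsCentralProj z) :
    z * e ≠ 0 ↔ z * c ≠ 0 := by
  refine not_congr ⟨fun h0 => ?_, fun h0 => ?_⟩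
  · have := h.le_of_mul_eq hz.one_sub (by rw [sub_mul, h0, one_mul, sub_zero])
    rwa [mul_sub, mul_one, sub_eq_self, ← hz.comm] at this
  · rw [← h.mul_eq, ← mul_assoc, h0, zero_mul]

theorem doubled (h : IsCentralCover e c) (he : Doubled e) : Doubled c :=
  he.centralCover h.1 fun _ hz hze => h.le_of_mul_eq hz hze

end IsCentralCover

/-- As `(yc)e = ye` for the central cover `c`, the restriction to `z ≤ c` amounts to `ye ≠ 0`, and
the cover drops out. -/
theorem isEquidimensional_iff {e : A} : IsEquidimensional e ↔ IsProperlyInfinite e ∧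
    ∀ y, IsCentralProj y → y * e ≠ 0 → dim (y * e) = dim e := by
  refine and_congr_right fun he => ⟨?_, fun h => ?_⟩
  · rintro ⟨c, hc, h⟩ y hy hy0
    have := h (y * c) (hy.mul hc.1) ((hc.mul_ne_zero_iff hy).mp hy0)
      (by rw [ProjLE, mul_assoc, hc.1.mul_self])
    rwa [mul_assoc, hc.mul_eq] at this
  · obtain ⟨c, hc⟩ := exists_isCentralCover e
    refine ⟨c, hc, fun z hz hz0 hzc => h z hz ((hc.mul_ne_zero_iff hz).mpr ?_)⟩
    rwa [← hzc.symm.symm]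

theorem IsEquidimensional.central_mul {e y : A} (h : IsEquidimensional e) (hy : IsCentralProj y)
    (hy0 : y * e ≠ 0) : IsEquidimensional (y * e) := by
  rw [isEquidimensional_iff] at h ⊢
  refine ⟨((Doubled.of_isProperlyInfinite h.1).central_mul hy).isProperlyInfinite hy0,
    fun x hx hx0 => ?_⟩
  rw [h.2 y hy hy0, ← mul_assoc, h.2 _ (hx.mul hy) (by rwa [mul_assoc])]

/-- Every central summand meeting a properly infinite projection contains one on which the
projection is equidimensional. -/
theorem exists_isEquidimensional {e w : A} (he : Doubled e) (hw : IsCentralProj w)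
    (h0 : w * e ≠ 0) : ∃ z, IsCentralProj z ∧ z * w = z ∧ IsEquidimensional (z * e) := by
  obtain ⟨z, hz, hzw, hz0, h⟩ := he.exists_constant_dim he.proj
    (IsStarProjection.mul_self he.proj) hw h0
  exact ⟨z, hz, hzw, isEquidimensional_iff.mpr ⟨(he.central_mul hz).isProperlyInfinite hz0, h⟩⟩

end AWStarAlgebra

/-! ### The spectrum of the centre -/

section Spectrum

variable {A : Type u} [CStarAlgebra A]

/-- The centre is the centralizer of the whole algebra. Closedness provides its C*-algebra
structure, and hence Gelfand duality. -/
instance isClosed_centre : IsClosed (centre A : Set A) := by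
  have : (centre A : Set A) = Set.centralizer Set.univ := by
    ext x
    simp only [Set.mem_centralizer_iff, Set.mem_univ, true_implies, SetLike.mem_coe]
    exact Subalgebra.mem_center_iff (R := ℂ)
  rw [this]
  exact Set.isClosed_centralizer _

noncomputable instance centre.instCommCStarAlgebra : CommCStarAlgebra (centre A) where
  __ := (inferInstance : CStarAlgebra (centre A))
  mul_comm a b := Subtype.ext ((Subalgebra.mem_center_iff (R := ℂ)).mp b.2 a)

variable {z w : centre A} {t : CenterSpec A}

theorem specSupport_mul : t ∈ specSupport (z * w) ↔ t ∈ specSupport z ∧ t ∈ specSupport w := by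
  simp [specSupport, map_mul]

theorem map_eq_zero_or_one (hz : IsCentralProj (z : A)) : t z = 0 ∨ t z = 1 := by
  have h : z * z = z := Subtype.ext hz.mul_self
  have := congrArg t h
  rw [map_mul] at this
  by_cases h0 : t z = 0
  · exact .inl h0
  · exact .inr (mul_left_cancel₀ h0 (this.trans (mul_one _).symm))

theorem specSupport_one_sub (hz : IsCentralProj (z : A)) :
    t ∈ specSupport (1 - z) ↔ t ∉ specSupport z := by
  rcases map_eq_zero_or_one (t := t) hz with h | h <;> simp [specSupport, h]

theorem isOpen_specSupport : IsOpen (specSupport z) := by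
  have : Continuous fun t : CenterSpec A => t z :=
    (WeakDual.eval_continuous z).comp continuous_subtype_val
  exact isOpen_ne_fun this continuous_const

theorem ne_zero_of_mem_specSupport (h : t ∈ specSupport z) : (z : A) ≠ 0 := by
  intro h0
  have : z = 0 := Subtype.ext h0
  exact h (by rw [this, map_zero])

/-- Injectivity of the Gelfand transform. -/
theorem exists_mem_specSupport (hz : (z : A) ≠ 0) : ∃ t, t ∈ specSupport z := by
  by_contra! h
  refine hz ?_
  have : WeakDual.gelfandTransform ℂ (centre A) z = 0 := by
    ext t
    have := h t
    simp only [specSupport, Set.mem_ofPred_eq, not_not] at this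
    exact this
  have h0 : z = 0 := (gelfandTransform_bijective (centre A)).1 (by rw [this, map_zero])
  rw [h0]; rfl

/-- Urysohn's lemma and surjectivity of the Gelfand transform give a nonzero central `x` whose
transform vanishes off `U`; a nonzero central projection that is a multiple of `xx*` is supported
inside `U`. -/
theorem exists_specSupport_subset [IsAWStarAlgebra A] {U : Set (CenterSpec A)} (hU : IsOpen U)
    (hne : U.Nonempty) : ∃ z : centre A, IsCentralProj (z : A) ∧ (z : A) ≠ 0 ∧
      specSupport z ⊆ U := by
  obtain ⟨t₀, ht₀⟩ := hne
  obtain ⟨f, hf₀, hf₁, -⟩ := exists_continuous_zero_one_of_isClosed hU.isClosed_compl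
    (isClosed_singleton (x := t₀)) (by simpa using ht₀)
  obtain ⟨x, hx⟩ := (gelfandTransform_bijective (centre A)).2
    ((⟨fun t => (f t : ℂ), by fun_prop⟩ : C(CenterSpec A, ℂ)))
  have hxt : ∀ t : CenterSpec A, t x = (f t : ℂ) := fun t => DFunLike.congr_fun hx t
  have hx0 : (x : A) ≠ 0 := by
    intro h
    have h' : x = 0 := Subtype.ext h
    have := hxt t₀
    rw [h', map_zero, hf₁ rfl] at this
    simp at this
  have hcomm : ∀ a, Commute ((x : A) * star (x : A)) a := fun a =>
    ((Subalgebra.mem_center_iff (R := ℂ)).mp (x * star x).2 a).symm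
  obtain ⟨z, y, hz, hz0, hy, hzy⟩ := exists_centralProj_mul hx0 hcomm
  have hyc : y ∈ centre A := (Subalgebra.mem_center_iff (R := ℂ)).mpr fun a => (hy a).eq.symm
  refine ⟨⟨z, hz.2⟩, hz, hz0, fun t ht => ?_⟩
  have h₁ : (⟨z, hz.2⟩ : centre A) = x * star x * ⟨y, hyc⟩ := Subtype.ext hzy
  rw [h₁, specSupport_mul, specSupport_mul] at ht
  by_contra htU
  exact ht.1.1 (by rw [hxt, hf₀ htU]; simp)

end Spectrum

/-! ### Dimension functions and the comparison theorem -/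

section DimensionFunction

variable {A : Type u} [CStarAlgebra A]

/-- The supremum of the dimensions `d(ze)` over the central projections `z ≤ c` supported
around `t`. -/
noncomputable def dimFunction (e : A) (c : centre A) (t : CenterSpec A) : Cardinal.{u} :=
  ⨆ z : {z : centre A // IsCentralProj (z : A) ∧ (z : A) * c = z ∧ t ∈ specSupport z},
    dim ((z : A) * e)

variable {e f : A} {c : centre A} {t : CenterSpec A}

theorem lt_dimFunction_iff {κ : Cardinal.{u}} : κ < dimFunction e c t ↔
    ∃ z : centre A, IsCentralProj (z : A) ∧ (z : A) * c = z ∧ t ∈ specSupport z ∧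
      κ < dim ((z : A) * e) := by
  rw [dimFunction, lt_ciSup_iff' Cardinal.bddAbove_of_small]
  constructor
  · rintro ⟨⟨z, hz, hzc, ht⟩, h⟩
    exact ⟨z, hz, hzc, ht, h⟩
  · rintro ⟨z, hz, hzc, ht, h⟩
    exact ⟨⟨z, hz, hzc, ht⟩, h⟩

variable [IsAWStarAlgebra A]

theorem continuous_dimFunction (he : Doubled e) (hc : IsCentralCover e (c : A)) :
    @Continuous (CenterSpec A) Cardinal.{u} inferInstance (Preorder.topology Cardinal.{u})
      (dimFunction e c) := by
  refine continuous_generateFrom_iff.mpr ?_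
  rintro _ ⟨κ, rfl | rfl⟩
  -- Upper rays: a projection witnessing `κ < D(t)` witnesses it on its whole support.
  · refine isOpen_iff_forall_mem_open.mpr fun t ht => ?_
    obtain ⟨z, hz, hzc, htz, hκ⟩ := lt_dimFunction_iff.mp ht
    exact ⟨specSupport z, fun t' ht' => lt_dimFunction_iff.mpr ⟨z, hz, hzc, ht', hκ⟩,
      isOpen_specSupport, htz⟩
  · refine isOpen_iff_forall_mem_open.mpr fun t ht => ?_
    -- Lower rays: `s` collects the central part where the dimension exceeds `D(t)`. Packings add up
    -- over it, so `t` lies off its support, and off this support maximality keeps the function at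
    -- most `D(t)`.
    obtain ⟨ι, Z, s, hZ, hs, hsc, hQ, hmax⟩ := exists_central_family
      (fun z : A => z * e ≠ 0 ∧ dimFunction e c t < dim (z * e)) (c : A)
    set s' : centre A := ⟨s, hs.2⟩ with hs'
    have hts : t ∉ specSupport s' := by
      intro hts
      have hse : s * e ≠ 0 := (hc.mul_ne_zero_iff hs).mpr (by
        rw [hsc]; exact ne_zero_of_mem_specSupport hts)
      have := he.lt_dim_of_central_sum he.proj (IsStarProjection.mul_self he.proj) hZ
        (fun i => (hQ i).1) (fun i => (hQ i).2) hse
      exact lt_irrefl _ (lt_dimFunction_iff.mpr ⟨s', hs, hsc, hts, this⟩)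
    refine ⟨specSupport (1 - s'), fun t' ht' => ?_, isOpen_specSupport,
      (specSupport_one_sub hs).mpr hts⟩
    have ht₀ : dimFunction e c t < κ := ht
    change dimFunction e c t' < κ
    refine lt_of_le_of_lt (not_lt.mp fun hlt => ?_) ht₀
    obtain ⟨z, hz, hzc, htz, hκ⟩ := lt_dimFunction_iff.mp hlt
    have hy : IsCentralProj ((z : A) * (1 - s)) := hz.mul hs.one_sub
    have hy0 : (z : A) * (1 - s) ≠ 0 :=
      ne_zero_of_mem_specSupport (z := z * (1 - s')) (specSupport_mul.mpr ⟨htz, ht'⟩)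
    have hyc : (z : A) * (1 - s) * c = z * (1 - s) := by
      rw [mul_assoc, hs.one_sub.comm, ← mul_assoc, hzc]
    have hye : (z : A) * (1 - s) * e ≠ 0 := (hc.mul_ne_zero_iff hy).mpr (by rwa [hyc])
    refine hy0 (hmax _ hy hyc ?_ ⟨hye, hκ.trans_le ?_⟩)
    · rw [mul_assoc, hs.1.one_sub_mul_self, mul_zero]
    · have h₁ : (z : A) * (1 - s) * e = (1 - s) * (z * e) := by
        rw [hz.comm, mul_assoc]
      rw [h₁] at hye ⊢
      exact dim_le_dim_central_mul (hz.mul_proj he.proj) hs.one_sub hye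

theorem isDimensionFunction_dimFunction (he : Doubled e) (hc : IsCentralCover e (c : A)) :
    IsDimensionFunction e (dimFunction e c) := by
  refine ⟨continuous_dimFunction he hc, c, hc, fun z hz hzc heq t ht => ?_, fun t ht => ?_⟩
  · refine le_antisymm (not_lt.mp fun hlt => ?_) (not_lt.mp fun hlt => ?_)
    -- Both supports contain `t`, so `zy ≠ 0`. Equidimensionality of `ze` forces `d(zye) = d(ze)`,
    -- yet `d(zye) ≥ d(ye)`.
    · obtain ⟨y, hy, hyc, hty, hκ⟩ := lt_dimFunction_iff.mp hlt
      have hzy0 : (z : A) * y ≠ 0 :=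
        ne_zero_of_mem_specSupport (z := z * y) (specSupport_mul.mpr ⟨ht, hty⟩)
      have hzye : (z : A) * y * e ≠ 0 :=
        (hc.mul_ne_zero_iff (hz.mul hy)).mpr (by rwa [mul_assoc, hyc])
      have h₁ : (y : A) * (z * e) = z * (y * e) := by rw [← mul_assoc, ← hz.comm, mul_assoc]
      rw [mul_assoc] at hzye
      have h₂ := (isEquidimensional_iff.mp heq).2 y hy (by rwa [h₁])
      have h₃ := dim_le_dim_central_mul (hy.mul_proj he.proj) hz hzye
      rw [← h₁, h₂] at h₃
      exact hκ.not_ge h₃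
    · exact lt_irrefl _ (lt_dimFunction_iff.mpr ⟨z, hz, Eq.symm hzc, ht, hlt⟩)
  · refine nonpos_iff_eq_zero.mp (not_lt.mp fun hlt => ?_)
    obtain ⟨z, hz, hzc, htz, -⟩ := lt_dimFunction_iff.mp hlt
    have : z * c = z := Subtype.ext hzc
    rw [← this, specSupport_mul] at htz
    exact (specSupport_one_sub hc.1).mp ht htz.2

/-- A common refinement to equidimensional summands of `e` and `f`. -/
theorem exists_common_isEquidimensional {c d z : A} (he : Doubled e) (hf : Doubled f)
    (hc : IsCentralCover e c) (hd : IsCentralCover f d) (hcd : c * d = c) (hz : IsCentralProj z)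
    (h0 : z * e ≠ 0) : ∃ w, IsCentralProj w ∧ w * z = w ∧ w * c = w ∧ w ≠ 0 ∧
      IsEquidimensional (w * e) ∧ IsEquidimensional (w * f) := by
  obtain ⟨y, hy, hyz, hye⟩ := exists_isEquidimensional he hz h0
  have hyc := hy.mul hc.1
  have hyc0 := (hc.mul_ne_zero_iff hy).mp hye.1.2.1
  obtain ⟨w, hw, hwy, hwf⟩ := exists_isEquidimensional hf hyc
    ((hd.mul_ne_zero_iff hyc).mpr (by rwa [mul_assoc, hcd]))
  have hwc : w * c = w := by rw [← hwy, mul_assoc, mul_assoc, hc.1.mul_self]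
  have hwy' : w * y = w := by
    rw [← hwy, mul_assoc, mul_assoc, hc.1.comm, mul_mul_of_eq hy.mul_self]
  have hw0 : w ≠ 0 := fun h => hwf.1.2.1 (by rw [h, zero_mul])
  refine ⟨w, hw, by rw [← hwy', mul_assoc, hyz], hwc, hw0, ?_, hwf⟩
  have h₁ : w * e = w * (y * e) := by rw [← mul_assoc, hwy']
  have hwe := (hc.mul_ne_zero_iff hw).mpr (by rwa [hwc])
  rw [h₁] at hwe ⊢
  exact hye.central_mul hw hwe

omit [IsAWStarAlgebra A] in
theorem IsDimensionFunction.eq_dim {D : CenterSpec A → Cardinal.{u}}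
    (hD : IsDimensionFunction e D) {c w : A} (hc : IsCentralCover e c) (hw : IsCentralProj w)
    (hwc : w * c = w) (hwe : IsEquidimensional (w * e))
    (ht : t ∈ specSupport (⟨w, hw.2⟩ : centre A)) : D t = dim (w * e) := by
  obtain ⟨-, c', hc', h, -⟩ := hD
  exact h ⟨w, hw.2⟩ hw (by rw [ProjLE, hc'.unique hc, hwc]) hwe t ht

omit [IsAWStarAlgebra A] in
theorem IsDimensionFunction.eq_zero {D : CenterSpec A → Cardinal.{u}}
    (hD : IsDimensionFunction e D) {c w : A} (hc : IsCentralCover e c) (hw : IsCentralProj w)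
    (hwc : w * c = 0) (ht : t ∈ specSupport (⟨w, hw.2⟩ : centre A)) : D t = 0 := by
  obtain ⟨-, c', hc', -, h⟩ := hD
  have hwc' : (⟨w, hw.2⟩ : centre A) * c' = 0 := Subtype.ext (by
    rw [← hc'.unique hc] at hwc
    exact hwc)
  refine h t ((specSupport_one_sub hc'.1).mpr fun htc => ?_)
  have := specSupport_mul.mpr ⟨ht, htc⟩
  rw [hwc'] at this
  exact ne_zero_of_mem_specSupport this rfl

/-- Dimension functions are monotone. -/
theorem IsDimensionFunction.le_of_subEquiv {De Df : CenterSpec A → Cardinal.{u}}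
    (he : Doubled e) (hf : Doubled f) (hDe : IsDimensionFunction e De)
    (hDf : IsDimensionFunction f Df) (h : SubEquiv e f) (t : CenterSpec A) : De t ≤ Df t := by
  let _ : TopologicalSpace Cardinal.{u} := Preorder.topology Cardinal.{u}
  have : OrderTopology Cardinal.{u} := ⟨rfl⟩
  -- Both functions are continuous into a linear order, so failure of the inequality is open and
  -- holds throughout the support of some nonzero central projection.
  have hopen : IsOpen {t | Df t < De t} := isOpen_lt hDf.1 hDe.1
  by_contra hlt
  obtain ⟨z, hz, hz0, hsub⟩ := exists_specSupport_subset hopen ⟨t, not_le.mp hlt⟩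
  obtain ⟨c, hc⟩ := exists_isCentralCover e
  obtain ⟨d, hd⟩ := exists_isCentralCover f
  have hde : d * e = e := h.central_absorb hf.proj hd.1 hd.mul_eq
  have hcd : c * d = c := hc.le_of_mul_eq hd.1 hde
  by_cases hze : (z : A) * e = 0
  · obtain ⟨s, hs⟩ := exists_mem_specSupport hz0
    have := hDe.eq_zero hc hz (not_not.mp fun h0 => (hc.mul_ne_zero_iff hz).mpr h0 hze) hs
    have hs' : Df s < De s := hsub hs
    rw [this] at hs'
    exact not_lt_zero hs'
  · obtain ⟨w, hw, hwz, hwc, hw0, hwe, hwf⟩ :=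
      exists_common_isEquidimensional he hf hc hd hcd hz hze
    obtain ⟨s, hs⟩ := exists_mem_specSupport (z := (⟨w, hw.2⟩ : centre A)) hw0
    have hs' : Df s < De s := by
      refine hsub ?_
      have hwz' : (⟨w, hw.2⟩ : centre A) * z = ⟨w, hw.2⟩ := Subtype.ext hwz
      rw [← hwz', specSupport_mul] at hs
      exact hs.2
    rw [hDe.eq_dim hc hw hwc hwe hs,
      hDf.eq_dim hd hw (by rw [← hwc, mul_assoc, hcd]) hwf hs] at hs'
    refine hs'.not_ge (Doubled.dim_le_of_subEquiv (hf.central_mul hw) (he.central_mul hw) hwe.1.2.1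
      (hw.mul_proj hf.proj) (IsStarProjection.mul_self (hw.mul_proj hf.proj))
      (h.central_mul he.proj hw) fun z hz hz0 => ((isEquidimensional_iff.mp hwf).2 z hz hz0).le)

/-- The comparison of dimension functions determines subequivalence. -/
theorem IsDimensionFunction.subEquiv_of_le {De Df : CenterSpec A → Cardinal.{u}}
    (he : Doubled e) (hf : Doubled f) (hDe : IsDimensionFunction e De)
    (hDf : IsDimensionFunction f Df) (hle : ∀ t, De t ≤ Df t) : SubEquiv e f := by
  obtain ⟨c, hc⟩ := exists_isCentralCover e
  obtain ⟨d, hd⟩ := exists_isCentralCover f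
  have hD : Doubled d := hd.doubled hf
  -- A part of `c` outside `d` would contain a summand on which `De` is positive while `Df`
  -- vanishes.
  have hcd : c * d = c := by
    suffices c * (1 - d) = 0 by
      rw [mul_sub, mul_one, sub_eq_zero] at this
      exact this.symm
    by_contra hne
    have hcd := hc.1.mul hd.1.one_sub
    obtain ⟨w, hw, hwc, hwe⟩ := exists_isEquidimensional he hcd
      ((hc.mul_ne_zero_iff hcd).mpr (by rwa [hcd.comm, mul_mul_of_eq hc.1.mul_self]))
    obtain ⟨t, ht⟩ := exists_mem_specSupport (z := (⟨w, hw.2⟩ : centre A))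
      (fun h => hwe.1.2.1 (by rw [show w = 0 from h, zero_mul]))
    have h₁ := hDe.eq_dim hc hw
      (by rw [← hwc, mul_assoc, hcd.comm, mul_mul_of_eq hc.1.mul_self]) hwe ht
    have h₂ := hDf.eq_zero hd hw
      (by rw [← hwc, mul_assoc, mul_assoc, hd.1.1.one_sub_mul_self, mul_zero, mul_zero]) ht
    have h₃ := hle t
    rw [h₁, h₂] at h₃
    exact h₃.not_gt ((he.central_mul hw).dim_pos hwe.1.2.1)
  have hde : d * e = e := by
    rw [hd.1.comm, ← hc.mul_eq, hc.1.comm, mul_assoc, hcd]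
  have hdf := hd.mul_eq
  have hed : e * d = e := by rw [← hd.1.comm, hde]
  have hfd : f * d = f := by rw [← hd.1.comm, hdf]
  -- Below `z₀` the claim already holds; the dimensions are needed only below `1 - z₀`, where `f ≾
  -- e`.
  obtain ⟨z₀, hz₀, h₁, h₂⟩ := hD.comparability he.proj hf.proj hed hfd
  obtain ⟨ι, Z, hZ, hQ⟩ := exists_central_partition (fun z => SubEquiv (z * e) (z * f)) hd.1 (by
    intro w hw hwd hw0
    by_cases hwz : w * z₀ = 0
    swap
    · refine ⟨w * z₀, hw.mul hz₀, by rw [mul_assoc, hz₀.comm, mul_mul_of_eq hw.mul_self], hwz, ?_⟩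
      rw [mul_assoc, mul_assoc]
      exact h₁.central_mul (hz₀.mul_proj he.proj) hw
    by_cases hwe : w * e = 0
    · refine ⟨w, hw, hw.mul_self, hw0, ?_⟩
      rw [hwe]
      exact SubEquiv.zero_left
    obtain ⟨y, hy, hyw, hyc, hy0, hye, hyf⟩ :=
      exists_common_isEquidimensional he hf hc hd hcd hw hwe
    have hyz : y * (1 - z₀) = y := by
      rw [mul_sub, mul_one, ← hyw, mul_assoc, hwz, mul_zero, sub_zero]
    have hyd : y * d = y := by rw [← hyc, mul_assoc, hcd]
    have hsub : SubEquiv (y * f) (y * e) := by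
      have := h₂.central_mul (hz₀.one_sub.mul_proj hf.proj) hy
      rwa [← mul_assoc, ← mul_assoc, hyz] at this
    obtain ⟨t, ht⟩ := exists_mem_specSupport (z := (⟨y, hy.2⟩ : centre A)) hy0
    have hdim := hle t
    rw [hDe.eq_dim hc hy hyc hye ht, hDf.eq_dim hd hy hyd hyf ht] at hdim
    -- Here `yf ≾ ye` while `d(ye) ≤ d(yf)`, so exhausting `ye` by copies of `yf` reverses the
    -- relation on some summand.
    obtain ⟨x, hx, hx0, hxs⟩ := hD.exists_central_subEquiv (hf.central_mul hy) hyf.1.2.1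
      (by rw [mul_assoc, hfd]) (hy.mul_proj he.proj) (by rw [mul_assoc, hed]) hsub hdim
      fun z hz hz0 => ((isEquidimensional_iff.mp hye).2 z hz hz0).le
    refine ⟨x * y, hx.mul hy, by rw [mul_assoc, hyw],
      fun h => hx0 (by rw [← mul_assoc, h, zero_mul]), ?_⟩
    rwa [mul_assoc, mul_assoc])
  have := hD.subEquiv_of_partition hZ (fun i => (hQ i).1) he.proj hf.proj fun i => (hQ i).2
  rwa [hde, hdf] at this

/-- Uniqueness is monotonicity applied to `e ≾ e` with two dimension functions of `e`, in both
orders. -/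
theorem existsUnique_isDimensionFunction (he : Doubled e) :
    ∃! D : CenterSpec A → Cardinal.{u}, IsDimensionFunction e D := by
  obtain ⟨c, hc⟩ := exists_isCentralCover e
  have hD := isDimensionFunction_dimFunction (c := ⟨c, hc.1.2⟩) he hc
  have hrefl := SubEquiv.of_equiv he.proj (.refl he.proj)
  exact ⟨_, hD, fun D hD' => funext fun t =>
    le_antisymm (hD'.le_of_subEquiv he he hD hrefl t) (hD.le_of_subEquiv he he hD' hrefl t)⟩

end DimensionFunction

end AWStar

theorem proposition5p7 {A : Type u} [CStarAlgebra A] [AWStar.IsAWStarAlgebra A]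
    (e f : A) (he : AWStar.IsProperlyInfinite e) (hf : AWStar.IsProperlyInfinite f) :
    (∃! D : AWStar.CenterSpec A → Cardinal.{u}, AWStar.IsDimensionFunction e D) ∧
    (∃! D : AWStar.CenterSpec A → Cardinal.{u}, AWStar.IsDimensionFunction f D) ∧
    ∀ De Df : AWStar.CenterSpec A → Cardinal.{u},
      AWStar.IsDimensionFunction e De → AWStar.IsDimensionFunction f Df →
        (AWStar.SubEquiv e f ↔ ∀ t, De t ≤ Df t) := by
  have he' := AWStar.Doubled.of_isProperlyInfinite he
  have hf' := AWStar.Doubled.of_isProperlyInfinite hf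
  exact ⟨AWStar.existsUnique_isDimensionFunction he', AWStar.existsUnique_isDimensionFunction hf',
    fun _ _ hDe hDf => ⟨fun h => hDe.le_of_subEquiv he' hf' hDf h,
      fun h => hDe.subEquiv_of_le he' hf' hDf h⟩⟩
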